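/- Let $\mathbb{G}$ be a finite quantum group, i.e. let $C(\mathbb{G})=\mathcal{O}(\mathbb{G})$ be a finite-dimensional C*-algebra which is a Hopf $*$-algebra with comultiplication $\Delta$, counit $\epsilon$ and antipode $S$. Let $\psi$ be the tracial $1$-form on $C(\mathbb{G})$, i.e. the unique faithful positive tracial functional with $mm^*=\mathrm{id}$, where $m$ is the multiplication and the adjoint is taken for $\langle x,y\rangle=\psi(x^*y)$. For $P\in C(\mathbb{G})$ let $P\,\star\colon C(\mathbb{G})\to C(\mathbb{G})$ be the convolution operator $P\star y=(\omega_P\otimes\mathrm{id})\Delta(y)$ with $\omega_P(z)=\psi(S(P)z)$. A linear map $A$ on $C(\mathbb{G})$ defines a quantum graph $(\mathbb{G},A)$ if $A\bullet A=A$ and $A(f^*)^*=A(f)$ for all $f$, where $A\bullet B=m(A\otimes B)m^*$; it has no loops if $A\bullet \mathrm{id}=0$. Then there are finitely many orthogonal projections $P_1,\dots,P_k\in C(\mathbb{G})$, with linear span $\ker\epsilon$ (the complement of the block of $C(\mathbb{G})$ that supports the counit), such that the quantum Cayley graphs $(\mathbb{G},A_i)$, $A_i=P_i\,\star$, are quantum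 graphs without loops and $$\mathbb{G}\;\cong\;\bigcap_{i=1}^k \mathrm{Qut}(\mathbb{G},A_i),$$ where $\mathbb{G}$ acts on itself by $\Delta$. Here $\bigcap_i \mathrm{Qut}(\mathbb{G},A_i)$ is the universal compact quantum group acting on $C(\mathbb{G})$ and preserving $\psi$ and every $A_i$. That is: $\mathcal{O}(\mathbb{G})$ is a CQG Hopf $*$-algebra, $\Delta$ is an action which preserves $\psi$ and all $A_i$, and for every compact quantum group $\mathbb{H}$ and every action $\beta\colon C(\mathbb{G})\to C(\mathbb{G})\otimes\mathcal{O}(\mathbb{H})$ which preserves $\psi$ and all $A_i$ there is a unique Hopf $*$-morphism $\gamma\colon\mathcal{O}(\mathbb{G})\to\mathcal{O}(\mathbb{H})$ with $(\mathrm{id}\otimes\gamma)\Delta=\beta$. Equivalently, and this is also asserted, for every orthonormal basis $(e_j)$ of $C(\mathbb{G})$ with respect to $\psi$, writing $\Delta(e_j)=\sum_i e_i\otimes u_{ij}$, the $*$-algebra $\mathcal{O}(\mathbb{G})$ is the universal unital $*$-algebra generated by the elements $u_{ij}$ subject to the relations that $U=(u_{ij})$ is unitary, $m(U\otimes U)=Um$,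 $U\eta=\eta$ (with $\eta$ the unit of $C(\mathbb{G})$) and $UA_i=A_iU$ for all $i$. -/

import Mathlib

open scoped TensorProduct ComplexOrder

universe u v

section FiniteQuantumSets

/-- The unital `*`-algebra `C` is a finite-dimensional C*-algebra: it has finite dimension and is
`*`-isomorphic to a `*`-subalgebra of some matrix algebra `M_n(ℂ)`. -/
class IsFinDimCStarAlgebra (C : Type u) [Ring C] [StarRing C] [Algebra ℂ C] [StarModule ℂ C] :
    Prop where
  finite : Module.Finite ℂ C
  faithful : ∃ (n : ℕ) (π : C →⋆ₐ[ℂ] Matrix (Fin n) (Fin n) ℂ), Function.Injective π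

attribute [instance] IsFinDimCStarAlgebra.finite

section AnyAlgebra

variable {C : Type u} [Ring C] [StarRing C] [Algebra ℂ C] [StarModule ℂ C]

/-- The functional `φ ⊗ φ` on `C ⊗ C`. -/
noncomputable def tensorSq (φ : C →ₗ[ℂ] ℂ) : (C ⊗[ℂ] C) →ₗ[ℂ] ℂ :=
  LinearMap.mul' ℂ ℂ ∘ₗ TensorProduct.map φ φ

/-- `δ : C → C ⊗ C` is the adjoint `m*` of the multiplication `m : C ⊗ C → C` with respect to the
inner products `⟨x, y⟩ = φ(x* y)` on `C` and `⟨s, t⟩ = (φ ⊗ φ)(s* t)` on `C ⊗ C`. -/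
def IsMulAdjoint (φ : C →ₗ[ℂ] ℂ) (δ : C →ₗ[ℂ] C ⊗[ℂ] C) : Prop :=
  ∀ (s : C ⊗[ℂ] C) (x : C),
    tensorSq φ (star s * δ x) = φ (star (LinearMap.mul' ℂ C s) * x)

/-- A tracial `1`-form: a faithful positive tracial functional such that `m m* = id`. -/
structure IsTracialOneForm (φ : C →ₗ[ℂ] ℂ) : Prop where
  pos : ∀ x, 0 ≤ φ (star x * x)
  faithful : ∀ x, φ (star x * x) = 0 → x = 0
  tracial : ∀ x y, φ (x * y) = φ (y * x)
  mul_adjoint : ∃ δ : C →ₗ[ℂ] C ⊗[ℂ] C,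
    IsMulAdjoint φ δ ∧ LinearMap.mul' ℂ C ∘ₗ δ = LinearMap.id

/-- The basis `e` is orthonormal for the inner product `⟨x, y⟩ = φ(x* y)`. -/
def IsOrthonormalFor (φ : C →ₗ[ℂ] ℂ) {n : ℕ} (e : Module.Basis (Fin n) ℂ C) : Prop :=
  ∀ i j, φ (star (e i) * e j) = if i = j then 1 else 0

theorem map_star_of_pos {φ : C →ₗ[ℂ] ℂ} (pos : ∀ x, 0 ≤ φ (star x * x)) (z : C) :
    φ (star z) = star (φ z) := by
  have im0 : ∀ x, (φ (star x * x)).im = 0 := fun x => ((Complex.le_def.1 (pos x)).2).symm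
  have h1 := im0 1
  have hz := im0 z
  have h2 := im0 (1 + z)
  have h3 := im0 (1 + Complex.I • z)
  simp only [star_add, star_one, star_smul, add_mul, mul_add, one_mul, mul_one, map_add,
    smul_mul_assoc, mul_smul_comm, map_smul, Complex.add_im, smul_eq_mul, RCLike.star_def,
    Complex.conj_I, Complex.mul_im, Complex.mul_re, Complex.I_re, Complex.I_im,
    Complex.neg_re, Complex.neg_im] at h1 h2 h3 hz
  apply Complex.ext
  · simp only [RCLike.star_def, Complex.conj_re]; linarith
  · simp only [RCLike.star_def, Complex.conj_im]; linarith

theorem exists_orthonormal_basis [Module.Finite ℂ C] {φ : C →ₗ[ℂ] ℂ}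
    (pos : ∀ x, 0 ≤ φ (star x * x)) (faithful : ∀ x, φ (star x * x) = 0 → x = 0) :
    ∃ (n : ℕ) (e : Module.Basis (Fin n) ℂ C), IsOrthonormalFor φ e := by
  let core : InnerProductSpace.Core ℂ C :=
    { inner := fun x y => φ (star x * y)
      conj_inner_symm := fun x y => by
        have := map_star_of_pos pos (star y * x)
        rw [star_mul, star_star] at this
        rw [this]; rfl
      re_inner_nonneg := fun x => (Complex.le_def.1 (pos x)).1
      add_left := fun x y z => by simp [add_mul]
      smul_left := fun x y r => by simp
      definite := fun x hx => faithful x hx }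
  let _ : NormedAddCommGroup C := core.toNormedAddCommGroup
  let _ : InnerProductSpace ℂ C := InnerProductSpace.ofCore core.toCore
  let b := stdOrthonormalBasis ℂ C
  refine ⟨_, b.toBasis, fun i j => ?_⟩
  have h := orthonormal_iff_ite.1 b.orthonormal i j
  simp only [OrthonormalBasis.coe_toBasis]
  exact h

section Basis

variable {φ : C →ₗ[ℂ] ℂ} {n : ℕ} {e : Module.Basis (Fin n) ℂ C}

theorem IsOrthonormalFor.repr_eq (he : IsOrthonormalFor φ e) (x : C) (i : Fin n) :
    e.repr x i = φ (star (e i) * x) := by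
  conv_rhs => rw [← e.sum_repr x]
  simp only [Finset.mul_sum, map_sum, mul_smul_comm, map_smul, he i, smul_eq_mul]
  simp

theorem IsOrthonormalFor.sum_smul (he : IsOrthonormalFor φ e) (x : C) :
    ∑ i, φ (star (e i) * x) • e i = x := by
  simp only [← he.repr_eq]; exact e.sum_repr x

theorem IsOrthonormalFor.trace_eq (he : IsOrthonormalFor φ e) (T : C →ₗ[ℂ] C) :
    LinearMap.trace ℂ C T = ∑ i, φ (star (e i) * T (e i)) := by
  rw [LinearMap.trace_eq_matrix_trace ℂ e, Matrix.trace]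
  simp [LinearMap.toMatrix_apply, he.repr_eq]

theorem IsOrthonormalFor.sum_star (he : IsOrthonormalFor φ e) (pos : ∀ x, 0 ≤ φ (star x * x))
    (b : C) : ∑ i, φ (star b * e i) • star (e i) = star b := by
  conv_rhs => rw [← he.sum_smul b, star_sum]
  refine Finset.sum_congr rfl fun i _ => ?_
  rw [star_smul, ← map_star_of_pos pos, star_mul, star_star]

/-- For a faithful positive trace and an orthonormal basis `e`, the adjoint of the multiplication
is `m*(x) = ∑ i, x (e i)* ⊗ e i`. -/
theorem IsOrthonormalFor.isMulAdjoint (he : IsOrthonormalFor φ e)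
    (pos : ∀ x, 0 ≤ φ (star x * x)) (tr : ∀ x y, φ (x * y) = φ (y * x)) :
    IsMulAdjoint φ (∑ i, (TensorProduct.mk ℂ C C).flip (e i) ∘ₗ
      LinearMap.mulRight ℂ (star (e i))) := by
  intro s x
  induction s using TensorProduct.induction_on with
  | zero => simp
  | add s t hs ht => simp only [star_add, add_mul, map_add, hs, ht]
  | tmul a b =>
    have h : ∑ i, φ (star a * (x * star (e i))) * φ (star b * e i) = φ (star a * x * star b) := by
      conv_rhs => rw [← he.sum_star pos b, Finset.mul_sum, map_sum]
      refine Finset.sum_congr rfl fun i _ => ?_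
      rw [mul_smul_comm, map_smul, smul_eq_mul, mul_comm, mul_assoc (star a)]
    simp only [tensorSq, LinearMap.sum_apply, LinearMap.comp_apply, LinearMap.flip_apply,
      TensorProduct.mk_apply, LinearMap.mulRight_apply, TensorProduct.star_tmul, Finset.mul_sum,
      Algebra.TensorProduct.tmul_mul_tmul, map_sum, TensorProduct.map_tmul,
      LinearMap.mul'_apply, h, star_mul]
    rw [tr, mul_assoc]

theorem IsMulAdjoint.unique (he : IsOrthonormalFor φ e) {δ δ' : C →ₗ[ℂ] C ⊗[ℂ] C}
    (h : IsMulAdjoint φ δ) (h' : IsMulAdjoint φ δ') : δ = δ' := by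
  ext x
  have key : ∀ t : C ⊗[ℂ] C, (∀ s, tensorSq φ (star s * t) = 0) → t = 0 := by
    intro t ht
    have hr : ∀ (t : C ⊗[ℂ] C) (i j : Fin n),
        (e.tensorProduct e).repr t (i, j) = tensorSq φ (star (e i ⊗ₜ[ℂ] e j) * t) := by
      intro t i j
      induction t using TensorProduct.induction_on with
      | zero => simp
      | add s t hs ht => simp only [mul_add, map_add, Finsupp.add_apply, hs, ht]
      | tmul a b =>
        simp [tensorSq, he.repr_eq, mul_comm]
    apply (e.tensorProduct e).repr.injective
    ext ⟨i, j⟩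
    rw [hr, ht, map_zero, Finsupp.zero_apply]
  rw [← sub_eq_zero]
  apply key
  intro s
  rw [mul_sub, map_sub, h s x, h' s x, sub_self]

theorem IsOrthonormalFor.sum_star_mul (he : IsOrthonormalFor φ e)
    (tr : ∀ x y, φ (x * y) = φ (y * x)) :
    ∑ i, star (e i) * e i = ∑ i, e i * star (e i) := by
  have h1 : ∀ i, star (e i) * e i = ∑ j, φ (star (e j) * star (e i)) • (e j * e i) := fun i => by
    conv_lhs => rw [← he.sum_smul (star (e i)), Finset.sum_mul]
    simp only [smul_mul_assoc]
  have h2 : ∀ i, e i * star (e i) = ∑ j, φ (star (e j) * star (e i)) • (e i * e j) := fun i => by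
    conv_lhs => rw [← he.sum_smul (star (e i)), Finset.mul_sum]
    simp only [mul_smul_comm]
  simp only [h1, h2]
  rw [Finset.sum_comm]
  refine Finset.sum_congr rfl fun i _ => Finset.sum_congr rfl fun j _ => ?_
  rw [tr]

end Basis

end AnyAlgebra

section OneForm

variable (C : Type u) [Ring C] [StarRing C] [Algebra ℂ C] [StarModule ℂ C]

/-- The tracial `1`-form `ψ` of a finite-dimensional C*-algebra `C`, given by
`ψ(a) = Tr(x ↦ a x)`; on `⨁ M_{n_α}` this is `⨁ n_α Tr_{n_α}`.  That it is the one and only tracial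
`1`-form is shown in `isTracialOneForm_iff`. -/
noncomputable def oneForm : C →ₗ[ℂ] ℂ := LinearMap.trace ℂ C ∘ₗ LinearMap.mul ℂ C

variable {C}

theorem oneForm_apply (x : C) : oneForm C x = LinearMap.trace ℂ C (LinearMap.mulLeft ℂ x) := rfl

theorem oneForm_mul_comm (x y : C) : oneForm C (x * y) = oneForm C (y * x) := by
  simp only [oneForm_apply, LinearMap.mulLeft_mul]
  exact LinearMap.trace_mul_comm ℂ _ _

theorem exists_faithful_pos [hC : IsFinDimCStarAlgebra C] : ∃ τ : C →ₗ[ℂ] ℂ,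
    (∀ x, 0 ≤ τ (star x * x)) ∧ ∀ x, τ (star x * x) = 0 → x = 0 := by
  obtain ⟨n, π, hπ⟩ := hC.faithful
  have hs : ∀ x, (Matrix.traceLinearMap (Fin n) ℂ ℂ ∘ₗ π.toAlgHom.toLinearMap) (star x * x) =
      Matrix.trace ((π x).conjTranspose * π x) := fun x => by
    rw [← Matrix.star_eq_conjTranspose, ← map_star, ← map_mul]; rfl
  refine ⟨Matrix.traceLinearMap (Fin n) ℂ ℂ ∘ₗ π.toAlgHom.toLinearMap, fun x => ?_, fun x hx => ?_⟩
  · rw [hs]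
    exact (Matrix.posSemidef_conjTranspose_mul_self (π x)).trace_nonneg
  · rw [hs, Matrix.trace_conjTranspose_mul_self_eq_zero_iff] at hx
    exact hπ (by rw [hx, map_zero])

theorem oneForm_pos [IsFinDimCStarAlgebra C] (x : C) : 0 ≤ oneForm C (star x * x) := by
  obtain ⟨τ, pos, faithful⟩ := exists_faithful_pos (C := C)
  obtain ⟨n, e, he⟩ := exists_orthonormal_basis pos faithful
  rw [oneForm_apply, he.trace_eq]
  refine Finset.sum_nonneg fun i _ => ?_
  have := pos (x * e i)
  rw [star_mul] at this
  simpa [mul_assoc] using this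

theorem oneForm_faithful [IsFinDimCStarAlgebra C] (x : C) (hx : oneForm C (star x * x) = 0) :
    x = 0 := by
  obtain ⟨τ, pos, faithful⟩ := exists_faithful_pos (C := C)
  obtain ⟨n, e, he⟩ := exists_orthonormal_basis pos faithful
  rw [oneForm_apply, he.trace_eq] at hx
  have hp : ∀ i, 0 ≤ τ (star (e i) * LinearMap.mulLeft ℂ (star x * x) (e i)) := fun i => by
    have := pos (x * e i)
    rw [star_mul] at this
    simpa [mul_assoc] using this
  rw [Finset.sum_eq_zero_iff_of_nonneg fun i _ => hp i] at hx
  have h0 : ∀ i, x * e i = 0 := fun i => by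
    apply faithful
    rw [star_mul]
    simpa [mul_assoc] using hx i (Finset.mem_univ i)
  have : LinearMap.mulLeft ℂ x = 0 := e.ext fun i => by simpa using h0 i
  simpa using LinearMap.congr_fun this 1

/-- A finite-dimensional C*-algebra has exactly one tracial `1`-form. -/
theorem isTracialOneForm_iff [IsFinDimCStarAlgebra C] (φ : C →ₗ[ℂ] ℂ) :
    IsTracialOneForm φ ↔ φ = oneForm C := by
  have aux : ∀ (φ : C →ₗ[ℂ] ℂ) (tr : ∀ x y, φ (x * y) = φ (y * x)) (n : ℕ)
      (e : Module.Basis (Fin n) ℂ C) (he : IsOrthonormalFor φ e) (y : C),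
      oneForm C y = φ (y * ∑ i, star (e i) * e i) := by
    intro φ tr n e he y
    rw [he.sum_star_mul tr, oneForm_apply, he.trace_eq, Finset.mul_sum, map_sum]
    refine Finset.sum_congr rfl fun i _ => ?_
    rw [tr, LinearMap.mulLeft_apply, mul_assoc]
  constructor
  · rintro ⟨pos, faithful, tr, δ, hδ, hm⟩
    obtain ⟨n, e, he⟩ := exists_orthonormal_basis pos faithful
    have h1 := LinearMap.congr_fun hm 1
    rw [hδ.unique he (he.isMulAdjoint pos tr)] at h1
    simp only [LinearMap.comp_apply, LinearMap.sum_apply, LinearMap.flip_apply,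
      TensorProduct.mk_apply, LinearMap.mulRight_apply, one_mul, map_sum,
      LinearMap.mul'_apply, LinearMap.id_apply] at h1
    ext y
    rw [aux φ tr n e he y, h1, mul_one]
  · rintro rfl
    obtain ⟨n, e, he⟩ := exists_orthonormal_basis (oneForm_pos (C := C)) oneForm_faithful
    refine ⟨oneForm_pos, oneForm_faithful, oneForm_mul_comm, _,
      he.isMulAdjoint oneForm_pos oneForm_mul_comm, ?_⟩
    have h1 : ∑ i, star (e i) * e i = 1 := by
      rw [← sub_eq_zero]
      apply oneForm_faithful
      rw [mul_sub, mul_one, map_sub, ← aux _ oneForm_mul_comm n e he, sub_self]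
    ext x
    simp only [LinearMap.comp_apply, LinearMap.sum_apply, LinearMap.flip_apply,
      TensorProduct.mk_apply, LinearMap.mulRight_apply, map_sum,
      LinearMap.mul'_apply, LinearMap.id_apply, mul_assoc]
    rw [← Finset.mul_sum, h1, mul_one]

theorem exists_mulAdjoint (C : Type u) [Ring C] [StarRing C] [Algebra ℂ C] [StarModule ℂ C]
    [IsFinDimCStarAlgebra C] : ∃ δ : C →ₗ[ℂ] C ⊗[ℂ] C, IsMulAdjoint (oneForm C) δ :=
  let ⟨δ, h, _⟩ := ((isTracialOneForm_iff (oneForm C)).2 rfl).mul_adjoint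
  ⟨δ, h⟩

variable [IsFinDimCStarAlgebra C]

variable (C) in
/-- The adjoint `m* : ℓ²(X) → ℓ²(X) ⊗ ℓ²(X)` of the multiplication, for the inner product of the
tracial `1`-form. -/
noncomputable def mulAdjoint : C →ₗ[ℂ] C ⊗[ℂ] C := (exists_mulAdjoint C).choose

theorem isMulAdjoint_mulAdjoint : IsMulAdjoint (oneForm C) (mulAdjoint C) :=
  (exists_mulAdjoint C).choose_spec

/-- The Schur product `A • B = m (A ⊗ B) m*`. -/
noncomputable def schurProduct (A B : C →ₗ[ℂ] C) : C →ₗ[ℂ] C :=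
  LinearMap.mul' ℂ C ∘ₗ TensorProduct.map A B ∘ₗ mulAdjoint C

/-- `A` is a quantum adjacency matrix on the finite quantum set `X` with `C(X) = C`, that is,
a real Schur idempotent: `A • A = A` and `A = Ā`, where `Ā f = (A f*)*`. -/
structure IsQuantumGraph (A : C →ₗ[ℂ] C) : Prop where
  schur_idempotent : schurProduct A A = A
  real : ∀ f, star (A (star f)) = A f

/-- The quantum graph `A` has no loops: `A • I = 0`. -/
def HasNoLoops (A : C →ₗ[ℂ] C) : Prop := schurProduct A LinearMap.id = 0

end OneForm

end FiniteQuantumSets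

section QuantumGroups

/-- A Hopf `*`-algebra: a complex Hopf algebra with an involution for which the comultiplication is
a `*`-homomorphism. -/
class IsHopfStarAlgebra (H : Type u) [Ring H] [StarRing H] [HopfAlgebra ℂ H] [StarModule ℂ H] :
    Prop where
  comul_star : ∀ x : H, Coalgebra.comul (R := ℂ) (star x) = star (Coalgebra.comul (R := ℂ) x)

/-- A finite-dimensional unitary corepresentation matrix `U = (u_{ij})` over `H`:
`U` is unitary and `Δ(u_{ij}) = ∑ k, u_{ik} ⊗ u_{kj}`. -/
structure IsUnitaryCorep {H : Type u} [Ring H] [StarRing H] [HopfAlgebra ℂ H] {n : ℕ}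
    (U : Matrix (Fin n) (Fin n) H) : Prop where
  conjTranspose_mul : U.conjTranspose * U = 1
  mul_conjTranspose : U * U.conjTranspose = 1
  comul_apply : ∀ i j, Coalgebra.comul (R := ℂ) (U i j) = ∑ k, U i k ⊗ₜ[ℂ] U k j

/-- A CQG Hopf `*`-algebra `H = O(ℍ)`, i.e. a compact quantum group `ℍ`: a Hopf `*`-algebra which is
the linear span of the matrix entries of its finite-dimensional unitary corepresentations. -/
class IsCQGAlgebra (H : Type u) [Ring H] [StarRing H] [HopfAlgebra ℂ H] [StarModule ℂ H] : Prop
    extends IsHopfStarAlgebra H where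
  span_coeff : Submodule.span ℂ {x : H | ∃ (n : ℕ) (U : Matrix (Fin n) (Fin n) H)
    (i j : Fin n), IsUnitaryCorep U ∧ x = U i j} = ⊤

/-- A finite quantum group `𝔾`, given by `A = C(𝔾) = O(𝔾)`: a finite-dimensional C*-algebra which
is a Hopf `*`-algebra. -/
class IsFiniteQuantumGroup (A : Type u) [Ring A] [StarRing A] [HopfAlgebra ℂ A]
    [StarModule ℂ A] : Prop extends IsFinDimCStarAlgebra A, IsHopfStarAlgebra A

end QuantumGroups

section Actions

/-- An action of the compact quantum group `ℍ` with `O(ℍ) = H` on the `*`-algebra `C`: an injective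
unital `*`-homomorphism `α : C → C ⊗ H` with `(α ⊗ id) α = (id ⊗ Δ) α`. -/
structure QuantumAction (C : Type u) (H : Type v) [Ring C] [StarRing C] [Algebra ℂ C]
    [StarModule ℂ C] [Ring H] [StarRing H] [HopfAlgebra ℂ H] [StarModule ℂ H] where
  toHom : C →⋆ₐ[ℂ] C ⊗[ℂ] H
  injective : Function.Injective toHom
  coaction : ∀ x, TensorProduct.assoc ℂ C H H
      (TensorProduct.map (toHom : C →ₗ[ℂ] C ⊗[ℂ] H) LinearMap.id (toHom x)) =
    TensorProduct.map LinearMap.id Coalgebra.comul (toHom x)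

variable {C : Type u} {H : Type v} [Ring C] [StarRing C] [Algebra ℂ C] [StarModule ℂ C]
  [Ring H] [StarRing H] [HopfAlgebra ℂ H] [StarModule ℂ H]

/-- The action preserves the functional `φ`: `(φ ⊗ id) α = φ(·) 1`. -/
def QuantumAction.PreservesForm (α : QuantumAction C H) (φ : C →ₗ[ℂ] ℂ) : Prop :=
  ∀ x, TensorProduct.lid ℂ H (TensorProduct.map φ LinearMap.id (α.toHom x)) = φ x • (1 : H)

/-- The action preserves the linear map `A`: `(A ⊗ id) α = α A`. -/
def QuantumAction.Commutes (α : QuantumAction C H) (A : C →ₗ[ℂ] C) : Prop :=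
  ∀ x, TensorProduct.map A LinearMap.id (α.toHom x) = α.toHom (A x)

/-- The action of `ℍ` on the finite quantum set `X`, `C(X) = C`, is an action on each of the
quantum graphs `(X, A i)`: it preserves the tracial `1`-form `ψ` and each `A i`. -/
structure QuantumAction.ActsOnGraphs {I : Type*} (α : QuantumAction C H) (A : I → C →ₗ[ℂ] C) :
    Prop where
  form : α.PreservesForm (oneForm C)
  commutes : ∀ i, α.Commutes (A i)

/-- The compact quantum group with algebra `O` and action `α` on `C = C(X)` is the intersection
`⋂ i, Qut(X, A i)` of the quantum automorphism groups of the quantum graphs `(X, A i)`: it is the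
universal compact quantum group acting on all of these graphs.  That is, `α` is such an action, and
for every compact quantum group `ℍ` (with `O(ℍ) = H`) with such an action `β` there is exactly one
Hopf `*`-morphism `γ : O → H` with `(id ⊗ γ) α = β`.  For a one-element family this is the defining
property of `Qut(X, A)`. -/
structure IsQutIntersection {O : Type u} [Ring O] [StarRing O] [HopfAlgebra ℂ O] [StarModule ℂ O]
    {I : Type*} (A : I → C →ₗ[ℂ] C) (α : QuantumAction C O) : Prop where
  isCQG : IsCQGAlgebra O
  acts : α.ActsOnGraphs A
  universal : ∀ (H : Type v) [Ring H] [StarRing H] [HopfAlgebra ℂ H] [StarModule ℂ H]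
    [IsCQGAlgebra H] (β : QuantumAction C H), β.ActsOnGraphs A →
    ∃! γ : O →ₐc[ℂ] H, (∀ x, γ (star x) = star (γ x)) ∧
      ∀ x, TensorProduct.map LinearMap.id (γ : O →ₗ[ℂ] H) (α.toHom x) = β.toHom x

end Actions

section Presentation

variable {C : Type u} [Ring C] [StarRing C] [Algebra ℂ C] [StarModule ℂ C]

/-- The matrix `(u_{ij})` of the action `α` in the basis `e`: `α(e j) = ∑ i, e i ⊗ u_{ij}`. -/
noncomputable def QuantumAction.coeffMatrix {H : Type v} [Ring H] [StarRing H] [HopfAlgebra ℂ H]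
    [StarModule ℂ H] (α : QuantumAction C H) {n : ℕ} (e : Module.Basis (Fin n) ℂ C) :
    Matrix (Fin n) (Fin n) H :=
  fun i j => TensorProduct.lid ℂ H (TensorProduct.map (e.coord i) LinearMap.id (α.toHom (e j)))

/-- The defining relations of `⋂ i, Qut(X, A i)` for a matrix `U` over a `*`-algebra `B`, with respect
to an orthonormal basis `e` of `ℓ²(X)`: `U` is unitary, `m (U ⊗ U) = U m`, `U η = η` and
`U (A i) = (A i) U` for all `i`. -/
structure QutRelations {n : ℕ} (e : Module.Basis (Fin n) ℂ C) {I : Type*} (A : I → C →ₗ[ℂ] C)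
    {B : Type v} [Ring B] [StarRing B] [Algebra ℂ B] (U : Matrix (Fin n) (Fin n) B) : Prop where
  conjTranspose_mul : U.conjTranspose * U = 1
  mul_conjTranspose : U * U.conjTranspose = 1
  mul : ∀ i j k, ∑ p, ∑ q, e.repr (e p * e q) i • (U p j * U q k) =
    ∑ l, e.repr (e j * e k) l • U i l
  unit : ∀ i, ∑ j, e.repr 1 j • U i j = e.repr 1 i • (1 : B)
  comm : ∀ a, U * (LinearMap.toMatrix e e (A a)).map (algebraMap ℂ B) =
    (LinearMap.toMatrix e e (A a)).map (algebraMap ℂ B) * U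

/-- The `*`-algebra `O`, with the matrix entries of the action `α`, is the universal `*`-algebra
generated by elements `u_{ij}` subject to the defining relations of all `Qut(X, A i)`. -/
def IsPresentedByQutRelations {O : Type u} [Ring O] [StarRing O] [HopfAlgebra ℂ O]
    [StarModule ℂ O] {I : Type*} (A : I → C →ₗ[ℂ] C) (α : QuantumAction C O) : Prop :=
  ∀ (n : ℕ) (e : Module.Basis (Fin n) ℂ C), IsOrthonormalFor (oneForm C) e →
    QutRelations e A (α.coeffMatrix e) ∧
    ∀ (B : Type v) [Ring B] [StarRing B] [Algebra ℂ B] [StarModule ℂ B]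
      (U : Matrix (Fin n) (Fin n) B), QutRelations e A U →
      ∃! f : O →⋆ₐ[ℂ] B, ∀ i j, f (α.coeffMatrix e i j) = U i j

end Presentation

section QuantumCayleyGraphs

variable {A : Type u} [Ring A] [StarRing A] [HopfAlgebra ℂ A] [StarModule ℂ A]

/-- `L_ω = (ω ⊗ id) Δ`. -/
noncomputable def leftConvolution (ω : A →ₗ[ℂ] ℂ) : A →ₗ[ℂ] A :=
  (TensorProduct.lid ℂ A).toLinearMap ∘ₗ TensorProduct.map ω LinearMap.id ∘ₗ Coalgebra.comul

/-- The convolution operator `x ⋆ = L_ω` with `ω(y) = ψ(S(x) y)`, where `S` is the antipode and `ψ`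
the tracial `1`-form.  For a projection `x = P` it is the adjacency matrix of a quantum Cayley
graph. -/
noncomputable def convolution (x : A) : A →ₗ[ℂ] A :=
  leftConvolution (oneForm A ∘ₗ LinearMap.mulLeft ℂ (HopfAlgebra.antipode ℂ x))

variable (A) in
/-- The action of a quantum group on itself given by the comultiplication. -/
noncomputable def comulAction [IsHopfStarAlgebra A] : QuantumAction A A where
  toHom := { Bialgebra.comulAlgHom ℂ A with map_star' := IsHopfStarAlgebra.comul_star }
  injective := fun x y h => by
    have h' : Coalgebra.comul (R := ℂ) x = Coalgebra.comul (R := ℂ) y := h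
    have hx := Coalgebra.rTensor_counit_comul (R := ℂ) x
    rw [h', Coalgebra.rTensor_counit_comul] at hx
    simpa using (congrArg (TensorProduct.lid ℂ A) hx).symm
  coaction := fun x => Coalgebra.coassoc_apply (R := ℂ) x

end QuantumCayleyGraphs

/-! The functional `ψ(a) = Tr(x ↦ a x)` is invariant under `Δ`: the canonical map `h ⊗ k ↦ Δ(h)(1 ⊗
k)` conjugates left multiplication by `x ⊗ 1` into left multiplication by `Δ(x)`, so `(ψ ⊗ ψ)Δ =
dim(A) ψ`, and faithfulness upgrades this to `(ψ ⊗ id)Δ = ψ(·)1` (`slice_oneForm_comul`). Invariance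
makes the matrix of `Δ` in an orthonormal basis unitary; as `ψ` is also a trace, `S` commutes with
the involution and `S² = id`.

Strong invariance (`convolution_eq_sum`) turns Schur products into products: `(x ⋆) • (y ⋆) = (xy)
⋆` and `(x ⋆) • id = ε(x) id`. Hence projections in `ker ε` give quantum graphs without loops. Since
`ker ε` is a `*`-ideal, spectral calculus shows that finitely many projections span it.

For universality, let `β` preserve `1` and `ψ` and commute with these `P ⋆`. It then commutes with
`1 ⋆ = ψ(·)1`, hence with every `p ⋆`, because `A = ker ε ⊕ ℂ1`. Every functional `ω` is `ψ(S(p)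
·)`, so `p ⋆ = (ω ⊗ id)Δ` and `ε ∘ (p ⋆) = ω`. With `f = (ε ⊗ id)β` this gives `(ω ⊗ id)β = (ε ⊗
id)β(p ⋆ ·) = (ω ⊗ f)Δ` for all `ω`, that is, `β = (id ⊗ f)Δ` (`map_slice_counit_comul`). For
actions and for matrices satisfying the relations alike, it remains to see that `f` respects the
additional structure. -/

set_option linter.unusedSectionVars false

/-! ### Slice maps on tensor products. -/

section Slices

variable {C : Type u} {H : Type v} [Ring C] [Algebra ℂ C] [Ring H] [Algebra ℂ H]

/-- The slice map `φ ⊗ id : C ⊗ H → H`. -/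
noncomputable def slice (H : Type v) [Ring H] [Algebra ℂ H] (φ : C →ₗ[ℂ] ℂ) : C ⊗[ℂ] H →ₗ[ℂ] H :=
  (TensorProduct.lid ℂ H).toLinearMap ∘ₗ TensorProduct.map φ LinearMap.id

@[simp]
theorem slice_tmul (φ : C →ₗ[ℂ] ℂ) (x : C) (y : H) : slice H φ (x ⊗ₜ[ℂ] y) = φ x • y := by
  simp [slice]

theorem slice_mul_right (φ : C →ₗ[ℂ] ℂ) (t : C ⊗[ℂ] H) (y : H) :
    slice H φ (t * (1 ⊗ₜ[ℂ] y)) = slice H φ t * y := by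
  induction t using TensorProduct.induction_on with
  | zero => simp
  | add s t hs ht => simp only [add_mul, map_add, hs, ht]
  | tmul a b => simp

theorem slice_mul_left (φ : C →ₗ[ℂ] ℂ) (t : C ⊗[ℂ] H) (y : H) :
    slice H φ ((1 ⊗ₜ[ℂ] y) * t) = y * slice H φ t := by
  induction t using TensorProduct.induction_on with
  | zero => simp
  | add s t hs ht => simp only [mul_add, map_add, hs, ht]
  | tmul a b => simp

theorem slice_star [StarRing C] [StarModule ℂ C] [StarRing H] [StarModule ℂ H] {φ : C →ₗ[ℂ] ℂ}
    (hφ : ∀ z, φ (star z) = star (φ z)) (t : C ⊗[ℂ] H) :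
    slice H φ (star t) = star (slice H φ t) := by
  induction t using TensorProduct.induction_on with
  | zero => simp
  | add s t hs ht => simp only [star_add, map_add, hs, ht]
  | tmul a b => simp [TensorProduct.star_tmul, hφ]

theorem tensorSq_eq_slice (φ : C →ₗ[ℂ] ℂ) (t : C ⊗[ℂ] C) :
    tensorSq φ t = φ (slice C φ t) := by
  induction t using TensorProduct.induction_on with
  | zero => simp
  | add s t hs ht => simp only [map_add, hs, ht]
  | tmul a b => simp [tensorSq]

theorem slice_map (φ : C →ₗ[ℂ] ℂ) (T : C →ₗ[ℂ] C) (t : C ⊗[ℂ] H) :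
    slice H φ (TensorProduct.map T LinearMap.id t) = slice H (φ ∘ₗ T) t := by
  induction t using TensorProduct.induction_on with
  | zero => simp
  | add s t hs ht => simp only [map_add, hs, ht]
  | tmul a b => simp

theorem slice_map_right {H' : Type*} [Ring H'] [Algebra ℂ H'] (φ : C →ₗ[ℂ] ℂ) (g : H →ₗ[ℂ] H')
    (t : C ⊗[ℂ] H) :
    slice H' φ (TensorProduct.map LinearMap.id g t) = g (slice H φ t) := by
  induction t using TensorProduct.induction_on with
  | zero => simp
  | add s t hs ht => simp only [map_add, hs, ht]
  | tmul a b => simp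

variable {n : ℕ} (e : Module.Basis (Fin n) ℂ C)

theorem sum_tmul_slice_coord (t : C ⊗[ℂ] H) :
    ∑ i, e i ⊗ₜ[ℂ] slice H (e.coord i) t = t := by
  induction t using TensorProduct.induction_on with
  | zero => simp
  | add s t hs ht => simp only [map_add, TensorProduct.tmul_add, Finset.sum_add_distrib, hs, ht]
  | tmul a b =>
    conv_rhs => rw [← e.sum_repr a, TensorProduct.sum_tmul]
    simp [TensorProduct.tmul_smul, TensorProduct.smul_tmul']

theorem slice_coord_sum (b : Fin n → H) (k : Fin n) :
    slice H (e.coord k) (∑ i, e i ⊗ₜ[ℂ] b i) = b k := by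
  classical
  simp [Finsupp.single_apply]

theorem eq_of_forall_slice_eq (e : Module.Basis (Fin n) ℂ C) {s t : C ⊗[ℂ] H}
    (h : ∀ φ : C →ₗ[ℂ] ℂ, slice H φ s = slice H φ t) : s = t := by
  rw [← sum_tmul_slice_coord e s, ← sum_tmul_slice_coord e t]
  simp only [h]

end Slices

/-! ### Matrix coefficients of actions and of the comultiplication. -/

section CoefficientMatrix

variable {C : Type u} {H : Type v} [Ring C] [StarRing C] [Algebra ℂ C] [StarModule ℂ C]
  [Ring H] [StarRing H] [HopfAlgebra ℂ H] [StarModule ℂ H] {n : ℕ}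

theorem QuantumAction.apply_basis (α : QuantumAction C H) (e : Module.Basis (Fin n) ℂ C)
    (j : Fin n) : α.toHom (e j) = ∑ i, e i ⊗ₜ[ℂ] α.coeffMatrix e i j :=
  (sum_tmul_slice_coord e _).symm

theorem QuantumAction.comul_coeffMatrix (α : QuantumAction C H) (e : Module.Basis (Fin n) ℂ C)
    (i j : Fin n) : Coalgebra.comul (R := ℂ) (α.coeffMatrix e i j) =
      ∑ k, α.coeffMatrix e i k ⊗ₜ[ℂ] α.coeffMatrix e k j := by
  have h := α.coaction (e j)
  have hl : ∀ x, (α.toHom : C →ₗ[ℂ] C ⊗[ℂ] H) x = α.toHom x := fun _ => rfl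
  rw [α.apply_basis e j] at h
  simp only [map_sum, TensorProduct.map_tmul, LinearMap.id_apply, hl, α.apply_basis e,
    TensorProduct.sum_tmul, TensorProduct.assoc_tmul] at h
  rw [Finset.sum_comm] at h
  simp only [← TensorProduct.tmul_sum] at h
  have h' := congrArg (slice (H ⊗[ℂ] H) (e.coord i)) h
  rw [slice_coord_sum, slice_coord_sum] at h'
  exact h'.symm

end CoefficientMatrix

section HopfCoefficients

variable {A : Type u} [Ring A] [StarRing A] [HopfAlgebra ℂ A] [StarModule ℂ A]
  [IsHopfStarAlgebra A] {n : ℕ} (e : Module.Basis (Fin n) ℂ A)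

theorem comul_basis (j : Fin n) : Coalgebra.comul (R := ℂ) (e j) =
    ∑ i, e i ⊗ₜ[ℂ] (comulAction A).coeffMatrix e i j :=
  (comulAction A).apply_basis e j

theorem sum_counit_smul_coeff (j : Fin n) :
    ∑ i, Coalgebra.counit (R := ℂ) (e i) • (comulAction A).coeffMatrix e i j = e j := by
  have h := congrArg (TensorProduct.lid ℂ A) (Coalgebra.rTensor_counit_comul (R := ℂ) (e j))
  rw [comul_basis e] at h
  simpa using h

theorem counit_coeff (i j : Fin n) :
    Coalgebra.counit (R := ℂ) ((comulAction A).coeffMatrix e i j) = if i = j then 1 else 0 := by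
  have h := congrArg (slice ℂ (e.coord i)) (Coalgebra.lTensor_counit_comul (R := ℂ) (e j))
  rw [comul_basis e] at h
  simp only [map_sum, LinearMap.lTensor_tmul] at h
  rw [← map_sum, slice_coord_sum] at h
  simpa [Finsupp.single_apply, eq_comm] using h

/-- The counit property writes each `e j` as a combination of column `j`, so the entries span
linearly and not only as an algebra. Linear identities on `A` may therefore be tested on entries. -/
theorem span_coeff : Submodule.span ℂ
    {x | ∃ i j, x = (comulAction A).coeffMatrix e i j} = ⊤ := by
  rw [eq_top_iff, ← e.span_eq, Submodule.span_le]
  rintro _ ⟨j, rfl⟩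
  rw [← sum_counit_smul_coeff e j]
  exact Submodule.sum_mem _ fun i _ => Submodule.smul_mem _ _ (Submodule.subset_span ⟨i, j, rfl⟩)

theorem coeff_induction {p : A → Prop} (coeff : ∀ i j, p ((comulAction A).coeffMatrix e i j))
    (zero : p 0) (add : ∀ x y, p x → p y → p (x + y)) (smul : ∀ (c : ℂ) x, p x → p (c • x))
    (x : A) : p x := by
  have hx : x ∈ Submodule.span ℂ {x | ∃ i j, x = (comulAction A).coeffMatrix e i j} := by
    rw [span_coeff e]; trivial
  induction hx using Submodule.span_induction with
  | mem x h => obtain ⟨i, j, rfl⟩ := h; exact coeff i j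
  | zero => exact zero
  | add x y _ _ hx hy => exact add x y hx hy
  | smul c x _ hx => exact smul c x hx

theorem coeff_mul_antipode :
    (comulAction A).coeffMatrix e * ((comulAction A).coeffMatrix e).map (HopfAlgebra.antipode ℂ) =
      1 := by
  ext i j
  have h := HopfAlgebra.mul_antipode_lTensor_comul_apply (R := ℂ)
    ((comulAction A).coeffMatrix e i j)
  rw [(comulAction A).comul_coeffMatrix, counit_coeff] at h
  simp only [map_sum, LinearMap.lTensor_tmul, LinearMap.mul'_apply] at h
  rw [Matrix.mul_apply, Matrix.one_apply]
  simp only [Matrix.map_apply, h]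
  split <;> simp

end HopfCoefficients

/-! ### Invariance of the tracial `1`-form. -/

section Haar

variable {A : Type u} [Ring A] [StarRing A] [HopfAlgebra ℂ A] [StarModule ℂ A]

theorem tensorSq_apply_eq_trace [Module.Finite ℂ A] (t : A ⊗[ℂ] A) :
    tensorSq (oneForm A) t = LinearMap.trace ℂ (A ⊗[ℂ] A) (LinearMap.mulLeft ℂ t) := by
  induction t using TensorProduct.induction_on with
  | zero => simp
  | add s t hs ht =>
    have : LinearMap.mulLeft ℂ (s + t) = LinearMap.mulLeft ℂ s + LinearMap.mulLeft ℂ t := by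
      ext; simp [add_mul]
    rw [map_add, hs, ht, this, map_add]
  | tmul a b =>
    have : LinearMap.mulLeft ℂ (a ⊗ₜ[ℂ] b) =
        TensorProduct.map (LinearMap.mulLeft ℂ a) (LinearMap.mulLeft ℂ b) := by
      ext; simp
    rw [this, LinearMap.trace_tensorProduct']
    simp [tensorSq, oneForm_apply]

/-- `ψ ⊗ ψ` is the regular trace of `A ⊗ A`. The bijection `W` conjugates left multiplication by `x
⊗ 1` into that by `Δ(x)`, so both have the same trace. -/
theorem tensorSq_comul [Module.Finite ℂ A] [IsHopfStarAlgebra A] (x : A) :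
    tensorSq (oneForm A) (Coalgebra.comul (R := ℂ) x) = Module.finrank ℂ A * oneForm A x := by
  let e := Module.finBasis ℂ A
  let U := (comulAction A).coeffMatrix e
  let V := U.map (HopfAlgebra.antipode ℂ)
  have hUV : U * V = 1 := coeff_mul_antipode e
  let W : A ⊗[ℂ] A →ₗ[ℂ] A ⊗[ℂ] A := TensorProduct.lift
    ((LinearMap.mul ℂ (A ⊗[ℂ] A)).compl₁₂ Coalgebra.comul (TensorProduct.mk ℂ A A 1))
  have hW : ∀ h k, W (h ⊗ₜ[ℂ] k) = Coalgebra.comul (R := ℂ) h * (1 ⊗ₜ[ℂ] k) := fun h k => rfl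
  let W' : A ⊗[ℂ] A →ₗ[ℂ] A ⊗[ℂ] A := TensorProduct.lift
    ((LinearMap.mul ℂ (A ⊗[ℂ] A)).compl₁₂ (TensorProduct.map LinearMap.id (HopfAlgebra.antipode ℂ)
      ∘ₗ Coalgebra.comul) (TensorProduct.mk ℂ A A 1))
  have hW' : ∀ h k, W' (h ⊗ₜ[ℂ] k) = TensorProduct.map LinearMap.id (HopfAlgebra.antipode ℂ)
    (Coalgebra.comul (R := ℂ) h) * (1 ⊗ₜ[ℂ] k) := fun h k => rfl
  have hWW' : W * W' = 1 := by
    refine TensorProduct.ext (e.ext fun j => LinearMap.ext fun k => ?_)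
    change W (W' (e j ⊗ₜ[ℂ] k)) = e j ⊗ₜ[ℂ] k
    have h1 : ∀ l, ∑ i, U l i * V i j = if l = j then 1 else 0 := fun l => by
      rw [← Matrix.mul_apply, hUV, Matrix.one_apply]
    rw [hW', comul_basis e]
    simp only [map_sum, TensorProduct.map_tmul, Finset.sum_mul, LinearMap.id_apply,
      Algebra.TensorProduct.tmul_mul_tmul, mul_one, hW, comul_basis e]
    rw [Finset.sum_comm]
    have h2 : ∀ l, ∑ i, e l ⊗ₜ[ℂ] (U l i * (V i j * k)) =
        if l = j then e j ⊗ₜ[ℂ] k else 0 := fun l => by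
      rw [← TensorProduct.tmul_sum]
      simp only [← mul_assoc]
      rw [← Finset.sum_mul, h1]
      split <;> simp_all
    exact (Finset.sum_congr rfl fun l _ => h2 l).trans (by simp)
  -- In finite dimension a one-sided inverse is two-sided.
  have hW'W : W' * W = 1 := mul_eq_one_comm.1 hWW'
  have hx : LinearMap.mulLeft ℂ (Coalgebra.comul (R := ℂ) x) * W =
      W * LinearMap.mulLeft ℂ (x ⊗ₜ[ℂ] (1 : A)) := by
    refine TensorProduct.ext' fun h k => ?_
    simp [hW, ← mul_assoc]
  have h1 : LinearMap.mulLeft ℂ (Coalgebra.comul (R := ℂ) x) =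
      W * LinearMap.mulLeft ℂ (x ⊗ₜ[ℂ] (1 : A)) * W' := by
    rw [← hx, mul_assoc, hWW', mul_one]
  rw [tensorSq_apply_eq_trace, h1, LinearMap.trace_mul_comm, ← mul_assoc, hW'W, one_mul,
    ← tensorSq_apply_eq_trace]
  simp [tensorSq, oneForm_apply, mul_comm]

/-- For `z = ∑ e i ⊗ b i` with `e` orthonormal, the value is the sum of the nonnegative numbers
`ψ((b i)* b i)`. -/
theorem tensorSq_faithful {C : Type u} [Ring C] [StarRing C] [Algebra ℂ C] [StarModule ℂ C]
    [IsFinDimCStarAlgebra C] (z : C ⊗[ℂ] C) (hz : tensorSq (oneForm C) (star z * z) = 0) :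
    z = 0 := by
  obtain ⟨n, e, he⟩ := exists_orthonormal_basis (oneForm_pos (C := C)) oneForm_faithful
  have h1 : ∀ b : Fin n → C, tensorSq (oneForm C)
      (star (∑ i, e i ⊗ₜ[ℂ] b i) * ∑ i, e i ⊗ₜ[ℂ] b i) = ∑ i, oneForm C (star (b i) * b i) := by
    intro b
    simp [star_sum, Finset.sum_mul, Finset.mul_sum, tensorSq, TensorProduct.star_tmul, he _ _]
  rw [← sum_tmul_slice_coord e z] at hz ⊢
  rw [h1, Finset.sum_eq_zero_iff_of_nonneg fun i _ => oneForm_pos _] at hz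
  refine Finset.sum_eq_zero fun i hi => ?_
  rw [oneForm_faithful _ (hz i hi), TensorProduct.tmul_zero]

variable [IsFiniteQuantumGroup A]

theorem oneForm_star (z : A) : oneForm A (star z) = star (oneForm A z) :=
  map_star_of_pos oneForm_pos z

/-- The tracial `1`-form of a finite quantum group is invariant. -/
theorem slice_oneForm_comul (x : A) :
    slice A (oneForm A) (Coalgebra.comul (R := ℂ) x) = oneForm A x • (1 : A) := by
  set ψ := oneForm A with hψ
  set N : ℂ := (Module.finrank ℂ A : ℂ) with hN
  have hΔ : ∀ y, tensorSq ψ (Coalgebra.comul (R := ℂ) y) = N * ψ y := tensorSq_comul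
  set b := slice A ψ (Coalgebra.comul (R := ℂ) x) with hb
  -- Coassociativity rewrites the left side as `((ψ ⊗ ψ)Δ ⊗ id)Δ(x)`, where `hΔ` applies.
  have hbb : slice A ψ (Coalgebra.comul (R := ℂ) b) = N • b := by
    let e := Module.finBasis ℂ A
    have h1 : ∀ t : A ⊗[ℂ] A, slice A ψ (Coalgebra.comul (R := ℂ) (slice A ψ t)) =
        slice A (tensorSq ψ) ((TensorProduct.assoc ℂ A A A).symm
          (Coalgebra.comul.lTensor A t)) := by
      intro t
      induction t using TensorProduct.induction_on with
      | zero => simp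
      | add s t hs ht => simp only [map_add, hs, ht]
      | tmul a c =>
        simp only [slice_tmul, map_smul, LinearMap.lTensor_tmul]
        generalize Coalgebra.comul (R := ℂ) c = s
        induction s using TensorProduct.induction_on with
        | zero => simp
        | add s t hs ht => simp only [map_add, smul_add, TensorProduct.tmul_add, hs, ht]
        | tmul p q => simp [tensorSq, mul_smul]
    rw [hb, h1, ← Coalgebra.coassoc_apply, LinearEquiv.symm_apply_apply]
    generalize Coalgebra.comul (R := ℂ) x = t
    induction t using TensorProduct.induction_on with
    | zero => simp
    | add s t hs ht => simp only [map_add, smul_add, hs, ht]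
    | tmul p q => simp [hΔ, mul_smul]
  -- Each of the four terms of `(ψ ⊗ ψ)(z* z)` has size `N ψ(b* b)`, the last one because `ψ(1) =
  -- N`; with their signs they cancel.
  have hz : Coalgebra.comul (R := ℂ) b - 1 ⊗ₜ[ℂ] b = 0 := by
    have hone : ψ 1 = N := by
      rw [hψ, oneForm_apply, LinearMap.mulLeft_one, LinearMap.trace_id]
    apply tensorSq_faithful
    have hs : star (Coalgebra.comul (R := ℂ) b - 1 ⊗ₜ[ℂ] b) =
        Coalgebra.comul (R := ℂ) (star b) - 1 ⊗ₜ[ℂ] star b := by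
      rw [star_sub, ← IsHopfStarAlgebra.comul_star, TensorProduct.star_tmul, star_one]
    have hsb : slice A ψ (Coalgebra.comul (R := ℂ) (star b)) = N • star b := by
      rw [IsHopfStarAlgebra.comul_star, slice_star (map_star_of_pos oneForm_pos), hbb, star_smul]
      simp [hN]
    rw [hs, sub_mul, mul_sub, mul_sub, ← Bialgebra.comul_mul, map_sub, map_sub, map_sub, hΔ]
    simp only [← hψ, tensorSq_eq_slice ψ, slice_mul_left, slice_mul_right, hbb, hsb]
    simp [hone]
  -- Applying `id ⊗ ε` to `Δ(b) = 1 ⊗ b` forces `b` to be a scalar.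
  have hb1 : b = Coalgebra.counit (R := ℂ) b • (1 : A) := by
    have h := Coalgebra.lTensor_counit_comul (R := ℂ) b
    rw [sub_eq_zero.1 hz, LinearMap.lTensor_tmul] at h
    have h' := congrArg (TensorProduct.rid ℂ A) h
    simpa using h'.symm
  have hε : Coalgebra.counit (R := ℂ) b = ψ x := by
    have h := congrArg (slice ℂ ψ) (Coalgebra.lTensor_counit_comul (R := ℂ) x)
    rw [LinearMap.lTensor, slice_map_right] at h
    simpa using h
  rw [hb1, hε]

end Haar

/-! ### Unitarity of the regular corepresentation; the antipode is an involution. -/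

section Antipode

variable {A : Type u} [Ring A] [StarRing A] [HopfAlgebra ℂ A] [StarModule ℂ A]
  [IsFiniteQuantumGroup A] {n : ℕ} {e : Module.Basis (Fin n) ℂ A}

/-- Invariance of `ψ`, evaluated at `(e j)* e k`. -/
theorem coeff_conjTranspose_mul (he : IsOrthonormalFor (oneForm A) e) :
    ((comulAction A).coeffMatrix e).conjTranspose * (comulAction A).coeffMatrix e = 1 := by
  ext j k
  have h := slice_oneForm_comul (star (e j) * e k)
  rw [Bialgebra.comul_mul, IsHopfStarAlgebra.comul_star, comul_basis e, comul_basis e, he] at h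
  simp only [star_sum, TensorProduct.star_tmul, Finset.sum_mul_sum,
    Algebra.TensorProduct.tmul_mul_tmul, map_sum, slice_tmul, he _ _] at h
  rw [Matrix.mul_apply, Matrix.one_apply]
  simpa using h

theorem coeff_antipode (he : IsOrthonormalFor (oneForm A) e) (i j : Fin n) :
    HopfAlgebra.antipode ℂ ((comulAction A).coeffMatrix e i j) =
      star ((comulAction A).coeffMatrix e j i) := by
  have h := left_inv_eq_right_inv (coeff_conjTranspose_mul he) (coeff_mul_antipode e)
  exact (congrFun (congrFun h i) j).symm

theorem coeff_mul_conjTranspose (he : IsOrthonormalFor (oneForm A) e) :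
    (comulAction A).coeffMatrix e * ((comulAction A).coeffMatrix e).conjTranspose = 1 := by
  rw [left_inv_eq_right_inv (coeff_conjTranspose_mul he) (coeff_mul_antipode e),
    coeff_mul_antipode]

/-- This is where traciality enters: it makes the adjoints of the basis orthonormal too, so the
transpose of `u` is a left inverse of the entrywise adjoint. Applying `S` to the relation `u* u = 1`
produces a right inverse, and the two agree. -/
theorem coeff_antipode_star (he : IsOrthonormalFor (oneForm A) e) (i j : Fin n) :
    HopfAlgebra.antipode ℂ (star ((comulAction A).coeffMatrix e i j)) =
      (comulAction A).coeffMatrix e j i := by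
  set u := (comulAction A).coeffMatrix e with hu
  have h1 : u.transpose * (u.map star) = 1 := by
    ext j k
    have h := slice_oneForm_comul (e j * star (e k))
    rw [Bialgebra.comul_mul, IsHopfStarAlgebra.comul_star, comul_basis e, comul_basis e,
      oneForm_mul_comm, he] at h
    simp only [star_sum, TensorProduct.star_tmul, Finset.sum_mul_sum,
      Algebra.TensorProduct.tmul_mul_tmul, map_sum, slice_tmul,
      oneForm_mul_comm (e _) (star (e _)), he _ _] at h
    rw [Matrix.mul_apply, Matrix.one_apply]
    simpa [eq_comm] using h
  have h2 : u.map star * (u.map fun x => HopfAlgebra.antipode ℂ (star x)) = 1 := by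
    ext j k
    have h := congrArg (HopfAlgebra.antipode ℂ)
      (congrFun (congrFun (coeff_conjTranspose_mul he) k) j)
    rw [Matrix.mul_apply, map_sum, Matrix.one_apply] at h
    simp only [HopfAlgebra.antipode_mul_antidistrib, Matrix.conjTranspose_apply,
      coeff_antipode he] at h
    rw [Matrix.mul_apply, Matrix.one_apply]
    simp only [Matrix.map_apply, hu]
    rw [h]
    by_cases hjk : j = k
    · simp [hjk, HopfAlgebra.antipode_one]
    · simp [hjk, Ne.symm hjk]
  have h := left_inv_eq_right_inv h1 h2
  exact (congrFun (congrFun h i) j).symm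

theorem antipode_star (x : A) :
    HopfAlgebra.antipode ℂ (star x) = star (HopfAlgebra.antipode ℂ x) := by
  obtain ⟨n, e, he⟩ := exists_orthonormal_basis (oneForm_pos (C := A)) oneForm_faithful
  induction x using coeff_induction e with
  | zero => simp
  | add x y hx hy => simp [hx, hy]
  | smul c x hx => simp [hx]
  | coeff i j => rw [coeff_antipode_star he, coeff_antipode he, star_star]

theorem antipode_antipode (x : A) :
    HopfAlgebra.antipode ℂ (HopfAlgebra.antipode ℂ x) = x := by
  obtain ⟨n, e, he⟩ := exists_orthonormal_basis (oneForm_pos (C := A)) oneForm_faithful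
  induction x using coeff_induction e with
  | zero => simp
  | add x y hx hy => simp [hx, hy]
  | smul c x hx => simp [hx]
  | coeff i j => rw [coeff_antipode he, coeff_antipode_star he]

theorem isCQGAlgebra_of_isFiniteQuantumGroup : IsCQGAlgebra A where
  span_coeff := by
    obtain ⟨n, e, he⟩ := exists_orthonormal_basis (oneForm_pos (C := A)) oneForm_faithful
    rw [eq_top_iff, ← span_coeff e]
    refine Submodule.span_mono ?_
    rintro x ⟨i, j, rfl⟩
    exact ⟨n, _, i, j, ⟨coeff_conjTranspose_mul he, coeff_mul_conjTranspose he,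
      (comulAction A).comul_coeffMatrix e⟩, rfl⟩

end Antipode

/-! ### Convolution operators and their Schur products. -/

section Convolution

variable {A : Type u} [Ring A] [StarRing A] [HopfAlgebra ℂ A] [StarModule ℂ A]

theorem convolution_apply (x y : A) : convolution x y = slice A
    (oneForm A ∘ₗ LinearMap.mulLeft ℂ (HopfAlgebra.antipode ℂ x)) (Coalgebra.comul (R := ℂ) y) :=
  rfl

theorem slice_mulLeft (φ : A →ₗ[ℂ] ℂ) (a : A) (t : A ⊗[ℂ] A) :
    slice A (φ ∘ₗ LinearMap.mulLeft ℂ a) t = slice A φ ((a ⊗ₜ[ℂ] 1) * t) := by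
  induction t using TensorProduct.induction_on with
  | zero => simp
  | add s t hs ht => simp only [mul_add, map_add, hs, ht]
  | tmul p q => simp

variable (A) in
/-- The convolution operators as a linear map `x ↦ x ⋆`. -/
noncomputable def convolutionMap : A →ₗ[ℂ] A →ₗ[ℂ] A where
  toFun := convolution
  map_add' x y := LinearMap.ext fun z => by
    simp only [convolution_apply, LinearMap.add_apply, slice_mulLeft, map_add,
      TensorProduct.add_tmul, add_mul]
  map_smul' c x := LinearMap.ext fun z => by
    simp only [convolution_apply, LinearMap.smul_apply, slice_mulLeft, map_smul,
      ← TensorProduct.smul_tmul', smul_mul_assoc, RingHom.id_apply]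

@[simp]
theorem convolutionMap_apply (x : A) : convolutionMap A x = convolution x := rfl

/-- Coassociativity: the convolution consumes the left leg of `Δ`, while the action of the group on
itself uses the right leg. -/
theorem map_convolution_comul (x y : A) :
    TensorProduct.map (convolution x) LinearMap.id (Coalgebra.comul (R := ℂ) y) =
      Coalgebra.comul (R := ℂ) (convolution x y) := by
  rw [convolution_apply]
  set ω := oneForm A ∘ₗ LinearMap.mulLeft ℂ (HopfAlgebra.antipode ℂ x) with hω
  have h1 : ∀ t : A ⊗[ℂ] A, TensorProduct.map (convolution x) LinearMap.id t =
      slice (A ⊗[ℂ] A) ω (TensorProduct.assoc ℂ A A A (Coalgebra.comul.rTensor A t)) := by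
    intro t
    induction t using TensorProduct.induction_on with
    | zero => simp
    | add s t hs ht => simp only [map_add, hs, ht]
    | tmul p q =>
      rw [TensorProduct.map_tmul, convolution_apply, ← hω, LinearMap.rTensor_tmul]
      generalize Coalgebra.comul (R := ℂ) p = s
      induction s using TensorProduct.induction_on with
      | zero => simp
      | add s t hs ht => simp only [map_add, TensorProduct.add_tmul, hs, ht]
      | tmul p q => simp [TensorProduct.smul_tmul']
  rw [h1, Coalgebra.coassoc_apply, LinearMap.lTensor, slice_map_right]

variable [IsFiniteQuantumGroup A]

theorem convolution_one (y : A) : convolution (1 : A) y = oneForm A y • (1 : A) := by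
  rw [convolution_apply, HopfAlgebra.antipode_one, LinearMap.mulLeft_one, LinearMap.comp_id,
    slice_oneForm_comul]

/-- Invariance at `(u l j)* y` says that `u*` sends the vector `(u k j ⋆ y)_k` to a vector of
scalars; multiplying by the unitary `u` solves for it. -/
theorem convolution_coeff {n : ℕ} {e : Module.Basis (Fin n) ℂ A}
    (he : IsOrthonormalFor (oneForm A) e) (i j : Fin n) (y : A) :
    convolution ((comulAction A).coeffMatrix e i j) y =
      ∑ l, oneForm A (HopfAlgebra.antipode ℂ ((comulAction A).coeffMatrix e l j) * y) •
        (comulAction A).coeffMatrix e i l := by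
  set U := (comulAction A).coeffMatrix e with hU
  have h1 : U.conjTranspose.mulVec (fun k => convolution (U k j) y) =
      fun l => oneForm A (HopfAlgebra.antipode ℂ (U l j) * y) • (1 : A) := by
    ext l
    have h := slice_oneForm_comul (star (U j l) * y)
    rw [Bialgebra.comul_mul, IsHopfStarAlgebra.comul_star, hU, (comulAction A).comul_coeffMatrix,
      ← hU, star_sum, Finset.sum_mul, map_sum] at h
    rw [hU, coeff_antipode he, ← hU, ← h, Matrix.mulVec, dotProduct]
    refine Finset.sum_congr rfl fun k _ => ?_
    rw [Matrix.conjTranspose_apply, convolution_apply, slice_mulLeft, ← slice_mul_left,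
      ← mul_assoc, hU, coeff_antipode he]
    simp [TensorProduct.star_tmul]
  have h2 := congrArg U.mulVec h1
  rw [Matrix.mulVec_mulVec, hU, coeff_mul_conjTranspose he, Matrix.one_mulVec] at h2
  rw [← hU] at h2
  refine (congrFun h2 i).trans ?_
  simp [Matrix.mulVec, dotProduct]

/-- Strong invariance: `x ⋆ y = ∑ ψ(S(x₍₂₎) y) x₍₁₎`. -/
theorem convolution_eq_sum {ι : Type*} {x : A} (r : Coalgebra.Repr ℂ x ι) (y : A) :
    convolution x y =
      ∑ i ∈ r.index, oneForm A (HopfAlgebra.antipode ℂ (r.right i) * y) • r.left i := by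
  obtain ⟨n, e, he⟩ := exists_orthonormal_basis (oneForm_pos (C := A)) oneForm_faithful
  let ω : A →ₗ[ℂ] ℂ := oneForm A ∘ₗ LinearMap.mulRight ℂ y ∘ₗ HopfAlgebra.antipode ℂ
  have h : ∀ x : A, convolution x y = TensorProduct.rid ℂ A
      (TensorProduct.map LinearMap.id ω (Coalgebra.comul (R := ℂ) x)) := by
    intro x
    induction x using coeff_induction e with
    | zero => simpa using LinearMap.congr_fun (convolutionMap A).map_zero y
    | add x z hx hz =>
      simpa [hx, hz] using LinearMap.congr_fun ((convolutionMap A).map_add x z) y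
    | smul c x hx =>
      refine (LinearMap.congr_fun ((convolutionMap A).map_smul c x) y).trans ?_
      simp [hx]
    | coeff i j =>
      rw [convolution_coeff he, (comulAction A).comul_coeffMatrix]
      simp [ω]
  rw [h, ← r.eq]
  simp [ω]

theorem schurProduct_eq_sum {C : Type u} [Ring C] [StarRing C] [Algebra ℂ C] [StarModule ℂ C]
    [IsFinDimCStarAlgebra C] {n : ℕ} {e : Module.Basis (Fin n) ℂ C}
    (he : IsOrthonormalFor (oneForm C) e) (S T : C →ₗ[ℂ] C) (x : C) :
    schurProduct S T x = ∑ i, S (x * star (e i)) * T (e i) := by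
  rw [schurProduct, isMulAdjoint_mulAdjoint.unique he
    (he.isMulAdjoint oneForm_pos oneForm_mul_comm)]
  simp

theorem sum_oneForm_smul_star {C : Type u} [Ring C] [StarRing C] [Algebra ℂ C] [StarModule ℂ C]
    [IsFinDimCStarAlgebra C] {n : ℕ} {e : Module.Basis (Fin n) ℂ C}
    (he : IsOrthonormalFor (oneForm C) e) (x : C) :
    ∑ i, oneForm C (x * e i) • star (e i) = x := by
  simpa using he.sum_star oneForm_pos (star x)

/-- By strong invariance the Schur product is a sum of `ψ(S(x₍₂₎) z (e i)*) ψ(S(y₍₂₎) e i) x₍₁₎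
y₍₁₎`. Summing over the basis merges the two values of `ψ` into `ψ(S(x₍₂₎) z S(y₍₂₎))`, which is
`ψ(S(x₍₂₎ y₍₂₎) z)` by traciality. -/
theorem schurProduct_convolution (x y : A) :
    schurProduct (convolution x) (convolution y) = convolution (x * y) := by
  obtain ⟨n, e, he⟩ := exists_orthonormal_basis (oneForm_pos (C := A)) oneForm_faithful
  ext z
  let r := Coalgebra.Repr.arbitrary ℂ x
  let s := Coalgebra.Repr.arbitrary ℂ y
  have hrs : Coalgebra.comul (R := ℂ) (x * y) = ∑ p ∈ r.index ×ˢ s.index,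
      (r.left p.1 * s.left p.2) ⊗ₜ[ℂ] (r.right p.1 * s.right p.2) := by
    rw [Bialgebra.comul_mul, ← r.eq, ← s.eq, Finset.sum_mul_sum, Finset.sum_product]
    simp
  rw [schurProduct_eq_sum he, convolution_eq_sum ⟨_, _, _, hrs.symm⟩, Finset.sum_product]
  simp only [convolution_eq_sum r, convolution_eq_sum s, Finset.sum_mul_sum]
  rw [Finset.sum_comm]
  refine Finset.sum_congr rfl fun a _ => ?_
  rw [Finset.sum_comm]
  refine Finset.sum_congr rfl fun b _ => ?_
  simp only [smul_mul_smul_comm, ← Finset.sum_smul, HopfAlgebra.antipode_mul_antidistrib]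
  congr 1
  have h := congrArg (fun t => oneForm A (HopfAlgebra.antipode ℂ (r.right a) * z * t))
    (sum_oneForm_smul_star he (HopfAlgebra.antipode ℂ (s.right b)))
  simp only [Finset.mul_sum, mul_smul_comm, map_sum, map_smul, smul_eq_mul] at h
  rw [mul_assoc (HopfAlgebra.antipode ℂ (s.right b)), oneForm_mul_comm, ← h]
  refine Finset.sum_congr rfl fun i _ => ?_
  rw [mul_comm, mul_assoc]

/-- The same contraction leaves `∑ x₍₁₎ S(x₍₂₎) z`, and the antipode axiom reduces this to `ε(x) z`.
-/
theorem schurProduct_convolution_id (x : A) :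
    schurProduct (convolution x) LinearMap.id =
      Coalgebra.counit (R := ℂ) x • (LinearMap.id : A →ₗ[ℂ] A) := by
  obtain ⟨n, e, he⟩ := exists_orthonormal_basis (oneForm_pos (C := A)) oneForm_faithful
  ext z
  let r := Coalgebra.Repr.arbitrary ℂ x
  rw [schurProduct_eq_sum he]
  simp only [convolution_eq_sum r, Finset.sum_mul]
  rw [Finset.sum_comm]
  have h : ∀ b : A, ∑ i, oneForm A (b * star (e i)) • e i = b := fun b => by
    simpa only [oneForm_mul_comm b] using he.sum_smul b
  simp only [LinearMap.id_apply, smul_mul_assoc, ← mul_smul_comm, ← Finset.mul_sum, ← mul_assoc, h]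
  simp only [← Finset.sum_mul, HopfAlgebra.sum_mul_antipode_eq_smul r]
  simp

theorem star_convolution_star {x : A} (hx : star x = x) (y : A) :
    star (convolution x (star y)) = convolution x y := by
  set ω := oneForm A ∘ₗ LinearMap.mulLeft ℂ (HopfAlgebra.antipode ℂ x) with hω
  have h : ∀ z, ω (star z) = star (ω z) := fun z => by
    simp only [hω, LinearMap.comp_apply, LinearMap.mulLeft_apply]
    rw [← oneForm_star, star_mul, ← antipode_star, hx, oneForm_mul_comm]
  rw [convolution_apply, convolution_apply, IsHopfStarAlgebra.comul_star, ← hω, slice_star h,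
    star_star]

theorem isQuantumGraph_convolution {P : A} (hP : IsStarProjection P) :
    IsQuantumGraph (convolution P) where
  schur_idempotent := by rw [schurProduct_convolution, hP.isIdempotentElem.eq]
  real := star_convolution_star hP.isSelfAdjoint.star_eq

theorem hasNoLoops_convolution {P : A} (hP : Coalgebra.counit (R := ℂ) P = 0) :
    HasNoLoops (convolution P) := by
  rw [HasNoLoops, schurProduct_convolution_id, hP, zero_smul]

/-- Every functional on a finite quantum group is of the form `ψ(S(x) ·)`. -/
theorem exists_antipode_oneForm_eq (ω : A →ₗ[ℂ] ℂ) :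
    ∃ x : A, oneForm A ∘ₗ LinearMap.mulLeft ℂ (HopfAlgebra.antipode ℂ x) = ω := by
  obtain ⟨n, e, he⟩ := exists_orthonormal_basis (oneForm_pos (C := A)) oneForm_faithful
  -- The sum is the element representing `ω` through `ψ`; the extra antipode is undone by `S² = id`.
  refine ⟨HopfAlgebra.antipode ℂ (∑ i, ω (e i) • star (e i)), e.ext fun j => ?_⟩
  rw [antipode_antipode]
  simp [Finset.sum_mul, he _ _]

end Convolution

/-! ### Projections spanning the kernel of the counit. -/

section Projections

open Polynomial in
/-- A self-adjoint element of a finite-dimensional C*-algebra is a linear combination of projections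
in the non-unital algebra which it generates. -/
theorem mem_span_isStarProjection {C : Type u} [Ring C] [StarRing C] [Algebra ℂ C]
    [StarModule ℂ C] [hC : IsFinDimCStarAlgebra C] {a : C} (ha : star a = a) :
    a ∈ Submodule.span ℂ {p : C | IsStarProjection p ∧ ∃ b, p = a * b} := by
  classical
  obtain ⟨n, π, hπ⟩ := hC.faithful
  have hsa : IsSelfAdjoint (π a) := by rw [IsSelfAdjoint, ← map_star, ha]
  have hfin : (spectrum ℝ (π a)).Finite := Matrix.finite_real_spectrum
  set s : Finset ℝ := hfin.toFinset with hs
  let ρ : C →ₐ[ℝ] Matrix (Fin n) (Fin n) ℂ := π.toAlgHom.restrictScalars ℝ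
  have hρ : ∀ x, ρ x = π x := fun _ => rfl
  -- Functional calculus in the faithful matrix representation: a polynomial in `a` depends only on
  -- its values on the spectrum.
  have key : ∀ f g : ℝ[X], (∀ μ ∈ s, f.eval μ = g.eval μ) → aeval a f = aeval a g := by
    intro f g hfg
    apply hπ
    rw [← hρ, ← hρ, ← aeval_algHom_apply, ← aeval_algHom_apply, hρ, ← cfc_polynomial f (π a) hsa,
      ← cfc_polynomial g (π a) hsa]
    exact cfc_congr fun μ hμ => hfg μ (by simpa [hs] using hμ)
  have hstar : ∀ f : ℝ[X], star (aeval a f) = aeval a f := by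
    intro f
    induction f using Polynomial.induction_on with
    | C r =>
      have : algebraMap ℝ C r = (r : ℂ) • (1 : C) := by
        rw [IsScalarTower.algebraMap_apply ℝ ℂ C, Algebra.algebraMap_eq_smul_one]; rfl
      simp [this]
    | add p q hp hq => simp [hp, hq]
    | monomial m r h =>
      have : algebraMap ℝ C r = (r : ℂ) • (1 : C) := by
        rw [IsScalarTower.algebraMap_apply ℝ ℂ C, Algebra.algebraMap_eq_smul_one]; rfl
      simp [this, ha]
  -- On the spectrum `X * g l` is the indicator of `l` for `l ≠ 0`, and vanishes for `l = 0` since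
  -- `0⁻¹ = 0`. The factor `X` keeps the projection in the ideal generated by `a`.
  let g : ℝ → ℝ[X] := fun l => Lagrange.interpolate s id (fun μ => if μ = l then μ⁻¹ else 0)
  have hg : ∀ l, ∀ μ ∈ s, (g l).eval μ = if μ = l then μ⁻¹ else 0 := fun l μ hμ =>
    Lagrange.eval_interpolate_at_node (v := id) _ (Set.injOn_id _) hμ
  let p : ℝ → C := fun l => aeval a (X * g l)
  have hp : ∀ l, IsStarProjection (p l) := fun l => by
    refine ⟨?_, hstar _⟩
    rw [IsIdempotentElem, ← map_mul]
    refine key _ _ fun μ hμ => ?_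
    simp only [eval_mul, eval_X, hg l μ hμ]
    split
    · by_cases h0 : μ = 0
      · simp [h0]
      · field_simp
    · simp
  have hsum : a = ∑ l ∈ s, (l : ℂ) • p l := by
    have h : aeval a (X : ℝ[X]) = aeval a (∑ l ∈ s, Polynomial.C l * (X * g l)) := by
      refine key _ _ fun μ hμ => ?_
      rw [eval_finsetSum, Finset.sum_eq_single μ]
      · simp only [eval_mul, eval_X, eval_C, hg μ μ hμ, if_true]
        by_cases h0 : μ = 0
        · simp [h0]
        · field_simp
      · intro l _ hl
        simp [hg l μ hμ, hl.symm]
      · exact fun h => absurd hμ h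
    rw [aeval_X, map_sum] at h
    rw [h]
    refine Finset.sum_congr rfl fun l _ => ?_
    rw [map_mul, aeval_C, IsScalarTower.algebraMap_apply ℝ ℂ C, ← Algebra.smul_def]
    rfl
  rw [hsum]
  refine Submodule.sum_mem _ fun l _ => Submodule.smul_mem _ _ (Submodule.subset_span ?_)
  rw [← hsum]
  exact ⟨hp l, aeval a (g l), by simp [p]⟩

variable {A : Type u} [Ring A] [StarRing A] [HopfAlgebra ℂ A] [StarModule ℂ A]

/-- Counits are unique: `x ↦ star (ε (star x))` is again a left counit, and evaluating it tensor `ε`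
on `Δ(x)` in both orders identifies the two. -/
theorem counit_star [IsHopfStarAlgebra A] (x : A) :
    Coalgebra.counit (R := ℂ) (star x) = star (Coalgebra.counit (R := ℂ) x) := by
  let ε' : A →ₗ[ℂ] ℂ :=
    { toFun := fun x => star (Coalgebra.counit (R := ℂ) (star x))
      map_add' := by simp
      map_smul' := by simp }
  have h1 : ∀ t : A ⊗[ℂ] A, slice A ε' t =
      star (slice A (Coalgebra.counit (R := ℂ)) (star t)) := by
    intro t
    induction t using TensorProduct.induction_on with
    | zero => simp
    | add s t hs ht => simp only [star_add, map_add, hs, ht]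
    | tmul a b => simp [TensorProduct.star_tmul, ε']
  have h2 : ∀ y : A, slice A (Coalgebra.counit (R := ℂ)) (Coalgebra.comul (R := ℂ) y) = y :=
    fun y => (congrArg (TensorProduct.lid ℂ A) (Coalgebra.rTensor_counit_comul (R := ℂ) y)).trans
      (by simp)
  have h3 : slice A ε' (Coalgebra.comul (R := ℂ) x) = x := by
    rw [h1, ← IsHopfStarAlgebra.comul_star, h2, star_star]
  have h4 : ε' x = Coalgebra.counit (R := ℂ) x := by
    have h := congrArg (slice ℂ ε') (Coalgebra.lTensor_counit_comul (R := ℂ) x)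
    rw [LinearMap.lTensor, slice_map_right, h3] at h
    simpa using h.symm
  exact (star_star _).symm.trans (congrArg star h4)

theorem exists_isStarProjection_span_eq_ker_counit [IsFiniteQuantumGroup A] :
    ∃ (k : ℕ) (P : Fin k → A), (∀ i, IsStarProjection (P i)) ∧
      Submodule.span ℂ (Set.range P) = LinearMap.ker (Coalgebra.counit (R := ℂ) (A := A)) := by
  set K := LinearMap.ker (Coalgebra.counit (R := ℂ) (A := A)) with hK
  set T : Set A := {p | IsStarProjection p ∧ p ∈ K} with hT
  have hsa : ∀ a ∈ K, star a = a → a ∈ Submodule.span ℂ T := fun a haK ha => by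
    refine Submodule.span_mono ?_ (mem_span_isStarProjection ha)
    rintro p ⟨hp, b, rfl⟩
    refine ⟨hp, ?_⟩
    rw [hK, LinearMap.mem_ker] at haK ⊢
    rw [Bialgebra.counit_mul, haK, zero_mul]
  have hspan : Submodule.span ℂ T = K := by
    apply le_antisymm
    · exact Submodule.span_le.2 fun p hp => hp.2
    · intro a haK
      have hsK : star a ∈ K := by
        rw [hK, LinearMap.mem_ker] at haK ⊢
        rw [counit_star, haK, star_zero]
      have h1 := hsa (a + star a) (add_mem haK hsK) (by simp [add_comm])
      have h2 := hsa (Complex.I • (a - star a)) (K.smul_mem _ (sub_mem haK hsK)) (by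
        simp [smul_sub, neg_add_eq_sub])
      have h3 : a = (2⁻¹ : ℂ) • (a + star a) +
          (-(2⁻¹ * Complex.I)) • (Complex.I • (a - star a)) := by
        rw [smul_smul, neg_mul, mul_assoc, Complex.I_mul_I]
        module
      rw [h3]
      exact add_mem (Submodule.smul_mem _ _ h1) (Submodule.smul_mem _ _ h2)
  -- A finite spanning set can be chosen among the projections themselves.
  obtain ⟨t, htT, ht⟩ := (Submodule.fg_span_iff_fg_span_finset_subset (R := ℂ) T).1
    (IsNoetherian.noetherian _)
  refine ⟨t.card, fun i => t.equivFin.symm i, fun i => (htT (t.equivFin.symm i).2).1, ?_⟩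
  rw [← hspan, ht]
  congr 1
  ext x
  constructor
  · rintro ⟨i, rfl⟩
    exact (t.equivFin.symm i).2
  · intro hx
    exact ⟨t.equivFin ⟨x, hx⟩, by simp⟩

end Projections

/-! ### Universality of the comultiplication. -/

section Universality

variable {A : Type u} [Ring A] [StarRing A] [HopfAlgebra ℂ A] [StarModule ℂ A]

theorem comulAction_actsOnGraphs [IsFiniteQuantumGroup A] {I : Type*} (P : I → A) :
    (comulAction A).ActsOnGraphs (fun i => convolution (P i)) where
  form := slice_oneForm_comul
  commutes _ _ := map_convolution_comul _ _

/-- Applying `ε` to the first leg recovers `f`. This gives uniqueness of the inducing map and,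
later, its compatibility with `ε`, `Δ` and the involution. -/
theorem map_id_comul_injective {M : Type*} [AddCommGroup M] [Module ℂ M] {f g : A →ₗ[ℂ] M}
    (h : ∀ x : A, TensorProduct.map LinearMap.id f (Coalgebra.comul (R := ℂ) x) =
      TensorProduct.map LinearMap.id g (Coalgebra.comul (R := ℂ) x)) : f = g := by
  ext x
  have key : ∀ f : A →ₗ[ℂ] M, f x = TensorProduct.lid ℂ M ((Coalgebra.counit (R := ℂ)).rTensor M
      (TensorProduct.map LinearMap.id f (Coalgebra.comul (R := ℂ) x))) := fun f => by
    have h1 := congrArg (fun t => TensorProduct.lid ℂ M (f.lTensor ℂ t))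
      (Coalgebra.rTensor_counit_comul (R := ℂ) x)
    simp only [LinearMap.lTensor_tmul, TensorProduct.lid_tmul, one_smul] at h1
    rw [← h1, LinearMap.lTensor, LinearMap.rTensor, LinearMap.rTensor, TensorProduct.map_map,
      TensorProduct.map_map, LinearMap.comp_id, LinearMap.comp_id, LinearMap.id_comp,
      LinearMap.id_comp]
  rw [key f, key g, h]

variable [IsFiniteQuantumGroup A]

/-- A linear map `β : A → A ⊗ B` which preserves `1` and the tracial `1`-form and commutes with the
convolution operators of a set of elements spanning the kernel of the counit is induced from the
comultiplication by `(ε ⊗ id) β`. -/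
theorem map_slice_counit_comul {B : Type v} [Ring B] [Algebra ℂ B] {β : A →ₗ[ℂ] A ⊗[ℂ] B}
    {I : Type*} {P : I → A}
    (hP : Submodule.span ℂ (Set.range P) = LinearMap.ker (Coalgebra.counit (R := ℂ) (A := A)))
    (one : β 1 = 1) (form : ∀ x, slice B (oneForm A) (β x) = oneForm A x • (1 : B))
    (comm : ∀ i x, TensorProduct.map (convolution (P i)) LinearMap.id (β x) =
      β (convolution (P i) x)) (x : A) :
    TensorProduct.map LinearMap.id (slice B (Coalgebra.counit (R := ℂ)) ∘ₗ β)
      (Coalgebra.comul (R := ℂ) x) = β x := by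
  -- The elements whose convolution commutes with `β` form a subspace, because `p ↦ p ⋆` is linear.
  let Z : Submodule ℂ A := LinearMap.eqLocus
    ((LinearMap.lcomp ℂ (A ⊗[ℂ] B) β) ∘ₗ (LinearMap.rTensorHom B) ∘ₗ convolutionMap A)
    ((LinearMap.llcomp ℂ A A (A ⊗[ℂ] B) β) ∘ₗ convolutionMap A)
  have hZ : ∀ p, p ∈ Z ↔ ∀ y, TensorProduct.map (convolution p) LinearMap.id (β y) =
      β (convolution p y) := fun p => LinearMap.ext_iff
  -- As `1 ⋆ = ψ(·)1`, this is preservation of `ψ` and of the unit.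
  have hone : (1 : A) ∈ Z := by
    rw [hZ]
    intro y
    have h1 : ∀ t : A ⊗[ℂ] B, TensorProduct.map (convolution (1 : A)) LinearMap.id t =
        1 ⊗ₜ[ℂ] slice B (oneForm A) t := fun t => by
      induction t using TensorProduct.induction_on with
      | zero => simp
      | add s t hs ht => simp only [map_add, TensorProduct.tmul_add, hs, ht]
      | tmul a b => simp [convolution_one, TensorProduct.smul_tmul']
    rw [h1, form, convolution_one, map_smul, one, TensorProduct.tmul_smul]
    rfl
  have hker : LinearMap.ker (Coalgebra.counit (R := ℂ) (A := A)) ≤ Z := by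
    rw [← hP, Submodule.span_le]
    rintro _ ⟨i, rfl⟩
    exact (hZ _).2 (comm i)
  have hall : ∀ p, p ∈ Z := fun p => by
    have h : p = (p - Coalgebra.counit (R := ℂ) p • (1 : A)) +
        Coalgebra.counit (R := ℂ) p • (1 : A) := by simp
    rw [h]
    exact add_mem (hker (by simp)) (Z.smul_mem _ hone)
  obtain ⟨n, e, he⟩ := exists_orthonormal_basis (oneForm_pos (C := A)) oneForm_faithful
  refine eq_of_forall_slice_eq e fun ω => ?_
  obtain ⟨p, hp⟩ := exists_antipode_oneForm_eq ω
  have hconv : ∀ y, convolution p y = slice A ω (Coalgebra.comul (R := ℂ) y) := fun y => by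
    rw [convolution_apply, hp]
  have hε : Coalgebra.counit (R := ℂ) ∘ₗ convolution p = ω := by
    ext y
    have h := congrArg (slice ℂ ω) (Coalgebra.lTensor_counit_comul (R := ℂ) y)
    rw [LinearMap.lTensor, slice_map_right, ← hconv] at h
    simpa using h
  rw [slice_map_right, ← hconv, LinearMap.comp_apply, ← (hZ p).1 (hall p), slice_map, hε]

/-- The algebra homomorphism `(ε ⊗ id) β`. -/
noncomputable def sliceCounitHom {B : Type v} [Ring B] [Algebra ℂ B] (β : A →ₐ[ℂ] A ⊗[ℂ] B) :
    A →ₐ[ℂ] B :=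
  ((Algebra.TensorProduct.lid ℂ B).toAlgHom.comp
    (Algebra.TensorProduct.map (Bialgebra.counitAlgHom ℂ A) (AlgHom.id ℂ B))).comp β

/-- Neither coassociativity nor compatibility with the involution is asked of `β`, so this serves
actions and matrices satisfying the relations alike. -/
theorem map_sliceCounitHom_comul {B : Type v} [Ring B] [Algebra ℂ B] {β : A →ₐ[ℂ] A ⊗[ℂ] B}
    {I : Type*} {P : I → A}
    (hP : Submodule.span ℂ (Set.range P) = LinearMap.ker (Coalgebra.counit (R := ℂ) (A := A)))
    (form : ∀ x, slice B (oneForm A) (β x) = oneForm A x • (1 : B))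
    (comm : ∀ i x, TensorProduct.map (convolution (P i)) LinearMap.id (β x) =
      β (convolution (P i) x)) (x : A) :
    TensorProduct.map LinearMap.id (sliceCounitHom β).toLinearMap
      (Coalgebra.comul (R := ℂ) x) = β x :=
  map_slice_counit_comul (β := β.toLinearMap) hP (map_one β) form comm x

/-! ### The inducing homomorphism of an action is a Hopf `*`-morphism. -/

section Action

variable {H : Type v} [Ring H] [StarRing H] [HopfAlgebra ℂ H] [StarModule ℂ H]
  (β : QuantumAction A H)

/-- Applying `ε` to the last leg of the coaction identity gives `β((id ⊗ ε)β(x)) = β(x)`, and `β` is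
injective. -/
theorem QuantumAction.map_id_counit (x : A) :
    TensorProduct.map LinearMap.id (Coalgebra.counit (R := ℂ)) (β.toHom x) = x ⊗ₜ[ℂ] (1 : ℂ) := by
  have h1 : ∀ t : A ⊗[ℂ] H, TensorProduct.map LinearMap.id
      ((TensorProduct.rid ℂ H).toLinearMap ∘ₗ (Coalgebra.counit (R := ℂ)).lTensor H)
      (TensorProduct.assoc ℂ A H H
        (TensorProduct.map (β.toHom : A →ₗ[ℂ] A ⊗[ℂ] H) LinearMap.id t)) =
      β.toHom (TensorProduct.rid ℂ A (TensorProduct.map LinearMap.id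
        (Coalgebra.counit (R := ℂ)) t)) := fun t => by
    induction t using TensorProduct.induction_on with
    | zero => simp
    | add s t hs ht => simp only [map_add, hs, ht]
    | tmul a b =>
      simp only [TensorProduct.map_tmul, LinearMap.id_apply, TensorProduct.rid_tmul, map_smul]
      change TensorProduct.map _ _ (TensorProduct.assoc ℂ A H H (β.toHom a ⊗ₜ[ℂ] b)) = _
      generalize β.toHom a = s
      induction s using TensorProduct.induction_on with
      | zero => simp
      | add s t hs ht => simp only [map_add, TensorProduct.add_tmul, smul_add, hs, ht]
      | tmul p q => simp
  have h2 : (TensorProduct.rid ℂ H).toLinearMap ∘ₗ (Coalgebra.counit (R := ℂ)).lTensor H ∘ₗ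
      Coalgebra.comul = LinearMap.id := by
    ext y
    simp
  have h3 := h1 (β.toHom x)
  rw [β.coaction, ← LinearMap.comp_apply, ← TensorProduct.map_comp, LinearMap.comp_assoc, h2,
    LinearMap.comp_id, TensorProduct.map_id, LinearMap.id_apply] at h3
  have h4 := β.injective h3
  apply (TensorProduct.rid ℂ A).injective
  rw [← h4]
  simp

/-- The algebra homomorphism inducing an action from the comultiplication is a morphism of Hopf
`*`-algebras. -/
theorem QuantumAction.exists_bialgHom {f : A →ₐ[ℂ] H}
    (hf : ∀ x, TensorProduct.map LinearMap.id f.toLinearMap (Coalgebra.comul (R := ℂ) x) =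
      β.toHom x) :
    ∃ γ : A →ₐc[ℂ] H, (∀ x, γ (star x) = star (γ x)) ∧
      ∀ x, TensorProduct.map LinearMap.id (γ : A →ₗ[ℂ] H) (Coalgebra.comul (R := ℂ) x) =
        β.toHom x := by
  have hcounit : Coalgebra.counit (R := ℂ) ∘ₗ f.toLinearMap = Coalgebra.counit (R := ℂ) := by
    refine map_id_comul_injective fun x => ?_
    have h : (Coalgebra.counit (R := ℂ) (A := A)).lTensor A (Coalgebra.comul (R := ℂ) x) =
      x ⊗ₜ[ℂ] 1 := Coalgebra.lTensor_counit_comul x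
    rw [LinearMap.lTensor] at h
    rw [h, ← β.map_id_counit, ← hf, TensorProduct.map_map, LinearMap.comp_id]
  -- After `(id ⊗ ·)Δ`, the left side becomes `(β ⊗ id)β` by coassociativity of `Δ`, and the right
  -- side becomes `(id ⊗ Δ)β`.
  have hcomul : TensorProduct.map f.toLinearMap f.toLinearMap ∘ₗ Coalgebra.comul =
      Coalgebra.comul ∘ₗ f.toLinearMap := by
    refine map_id_comul_injective fun x => ?_
    have h1 : ∀ t : A ⊗[ℂ] A, TensorProduct.map LinearMap.id
        (TensorProduct.map f.toLinearMap f.toLinearMap)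
          (TensorProduct.assoc ℂ A A A (Coalgebra.comul.rTensor A t)) =
        TensorProduct.assoc ℂ A H H (TensorProduct.map (β.toHom : A →ₗ[ℂ] A ⊗[ℂ] H) LinearMap.id
          (TensorProduct.map LinearMap.id f.toLinearMap t)) := fun t => by
      induction t using TensorProduct.induction_on with
      | zero => simp
      | add s t hs ht => simp only [map_add, hs, ht]
      | tmul a b =>
        simp only [LinearMap.rTensor_tmul, TensorProduct.map_tmul, LinearMap.id_apply]
        change _ = TensorProduct.assoc ℂ A H H (β.toHom a ⊗ₜ[ℂ] f b)
        rw [← hf]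
        generalize Coalgebra.comul (R := ℂ) a = s
        induction s using TensorProduct.induction_on with
        | zero => simp
        | add s t hs ht => simp only [map_add, TensorProduct.add_tmul, hs, ht]
        | tmul p q => simp
    have h2 := h1 (Coalgebra.comul (R := ℂ) x)
    rw [Coalgebra.coassoc_apply, hf, β.coaction, LinearMap.lTensor, ← LinearMap.comp_apply,
      ← TensorProduct.map_comp, LinearMap.comp_id] at h2
    rw [h2, ← hf, ← LinearMap.comp_apply, ← TensorProduct.map_comp, LinearMap.comp_id]
  have hstar : ∀ x, f (star x) = star (f x) := by
    let g : A →ₗ[ℂ] H :=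
      { toFun := fun x => star (f (star x))
        map_add' := by simp
        map_smul' := by simp }
    have hg : g = f.toLinearMap := by
      refine map_id_comul_injective fun x => ?_
      have h1 : ∀ t : A ⊗[ℂ] A, TensorProduct.map LinearMap.id g t =
          star (TensorProduct.map LinearMap.id f.toLinearMap (star t)) := fun t => by
        induction t using TensorProduct.induction_on with
        | zero => simp
        | add s t hs ht => simp only [star_add, map_add, hs, ht]
        | tmul a b => simp [TensorProduct.star_tmul, g]
      rw [h1, ← IsHopfStarAlgebra.comul_star, hf, hf, map_star, star_star]
    intro x
    exact (star_star _).symm.trans (congrArg star (LinearMap.congr_fun hg x))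
  exact ⟨BialgHom.ofAlgHom f (AlgHom.toLinearMap_injective hcounit)
    (AlgHom.toLinearMap_injective hcomul), hstar, hf⟩

end Action

theorem isQutIntersection_comulAction {I : Type*} {P : I → A}
    (hP : Submodule.span ℂ (Set.range P) = LinearMap.ker (Coalgebra.counit (R := ℂ) (A := A))) :
    IsQutIntersection.{u, v} (fun i => convolution (P i)) (comulAction A) where
  isCQG := isCQGAlgebra_of_isFiniteQuantumGroup
  acts := comulAction_actsOnGraphs P
  universal H _ _ _ _ _ β hβ := by
    obtain ⟨γ, hγ, hγβ⟩ := β.exists_bialgHom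
      (map_sliceCounitHom_comul (β := β.toHom.toAlgHom) hP hβ.form hβ.commutes)
    refine ⟨γ, ⟨hγ, hγβ⟩, fun γ' ⟨_, h⟩ => ?_⟩
    have h' := map_id_comul_injective (f := (γ' : A →ₗ[ℂ] H)) (g := (γ : A →ₗ[ℂ] H))
      fun x => (h x).trans (hγβ x).symm
    exact DFunLike.ext _ _ fun x => LinearMap.congr_fun h' x

/-! ### The presentation by generators and relations. -/

section Presentation

variable {n : ℕ} {e : Module.Basis (Fin n) ℂ A}

theorem qutRelations_coeffMatrix (he : IsOrthonormalFor (oneForm A) e) {I : Type*} (P : I → A) :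
    QutRelations e (fun i => convolution (P i)) ((comulAction A).coeffMatrix e) where
  conjTranspose_mul := coeff_conjTranspose_mul he
  mul_conjTranspose := coeff_mul_conjTranspose he
  mul i j k := by
    have h := Bialgebra.comul_mul (R := ℂ) (e j) (e k)
    conv_lhs at h => rw [← e.sum_repr (e j * e k)]
    simp only [map_sum, map_smul, comul_basis e, Finset.sum_mul_sum,
      Algebra.TensorProduct.tmul_mul_tmul] at h
    have h' := congrArg (slice A (e.coord i)) h
    simp only [map_sum, map_smul, slice_tmul, Module.Basis.coord_apply] at h'
    rw [← h']
    simp [Finsupp.single_apply]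
  unit i := by
    have h := Bialgebra.comul_one (R := ℂ) (A := A)
    conv_lhs at h => rw [← e.sum_repr 1]
    have h' := congrArg (slice A (e.coord i)) h
    simp only [map_sum, map_smul, comul_basis e, Algebra.TensorProduct.one_def, slice_tmul,
      Module.Basis.coord_apply] at h'
    rw [← h']
    simp [Finsupp.single_apply]
  comm a := by
    ext i j
    have h := map_convolution_comul (P a) (e j)
    conv_rhs at h => rw [← e.sum_repr (convolution (P a) (e j))]
    have h' := congrArg (slice A (e.coord i)) h
    simp only [map_sum, map_smul, comul_basis e, TensorProduct.map_tmul, slice_tmul,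
      Module.Basis.coord_apply, LinearMap.id_apply] at h'
    simp only [Matrix.mul_apply, Matrix.map_apply, LinearMap.toMatrix_apply,
      ← Algebra.smul_def, ← Algebra.commutes]
    rw [h']
    simp [Finsupp.single_apply]

variable {I : Type*} {T : I → A →ₗ[ℂ] A} {B : Type v} [Ring B] [StarRing B] [Algebra ℂ B]
  {U : Matrix (Fin n) (Fin n) B}

/-- The homomorphism `e j ↦ ∑ i, e i ⊗ U i j` of a matrix satisfying the relations. -/
noncomputable def QutRelations.toAlgHom (hU : QutRelations e T U) : A →ₐ[ℂ] A ⊗[ℂ] B :=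
  AlgHom.ofLinearMap (e.constr ℂ fun j => ∑ i, e i ⊗ₜ[ℂ] U i j)
    (by
      rw [← e.sum_repr 1]
      simp only [map_sum, map_smul, e.constr_basis, Finset.smul_sum]
      rw [Finset.sum_comm]
      simp only [← TensorProduct.tmul_smul, ← TensorProduct.tmul_sum, hU.unit]
      simp only [TensorProduct.tmul_smul, TensorProduct.smul_tmul', ← TensorProduct.sum_tmul]
      rw [e.sum_repr, Algebra.TensorProduct.one_def])
    (by
      have h : (e.constr ℂ fun j => ∑ i, e i ⊗ₜ[ℂ] U i j) ∘ₗ LinearMap.mul' ℂ A =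
          LinearMap.mul' ℂ (A ⊗[ℂ] B) ∘ₗ TensorProduct.map
            (e.constr ℂ fun j => ∑ i, e i ⊗ₜ[ℂ] U i j)
            (e.constr ℂ fun j => ∑ i, e i ⊗ₜ[ℂ] U i j) := by
        refine (e.tensorProduct e).ext fun ⟨j, k⟩ => ?_
        simp only [Module.Basis.tensorProduct_apply, LinearMap.comp_apply, LinearMap.mul'_apply,
          TensorProduct.map_tmul, e.constr_basis]
        conv_lhs => rw [← e.sum_repr (e j * e k)]
        simp only [map_sum, map_smul, e.constr_basis, Finset.smul_sum]
        rw [Finset.sum_comm]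
        simp only [← TensorProduct.tmul_smul, ← TensorProduct.tmul_sum, ← hU.mul]
        simp only [TensorProduct.tmul_sum, TensorProduct.tmul_smul, TensorProduct.smul_tmul',
          Finset.sum_mul_sum, Algebra.TensorProduct.tmul_mul_tmul]
        rw [Finset.sum_comm]
        refine Finset.sum_congr rfl fun p _ => ?_
        rw [Finset.sum_comm]
        refine Finset.sum_congr rfl fun q _ => ?_
        rw [← TensorProduct.sum_tmul, e.sum_repr]
      exact fun x y => LinearMap.congr_fun h (x ⊗ₜ y))

theorem QutRelations.toAlgHom_basis (hU : QutRelations e T U) (j : Fin n) :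
    hU.toAlgHom (e j) = ∑ i, e i ⊗ₜ[ℂ] U i j :=
  e.constr_basis ℂ _ j

/-- Unitarity turns `U η = η` into `U* η = η`. The coordinates of `1` are the conjugates of `ψ(e
i)`, so the adjoint of this relation is preservation of `ψ`. -/
theorem QutRelations.slice_toAlgHom [StarModule ℂ B] (he : IsOrthonormalFor (oneForm A) e)
    (hU : QutRelations e T U) (x : A) :
    slice B (oneForm A) (hU.toAlgHom x) = oneForm A x • (1 : B) := by
  have h1 : U.mulVec (fun j => e.repr 1 j • (1 : B)) = fun i => e.repr 1 i • (1 : B) := by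
    ext i
    simpa [Matrix.mulVec, dotProduct] using hU.unit i
  have h2 : ∀ i, e.repr 1 i = star (oneForm A (e i)) := fun i => by
    rw [he.repr_eq, mul_one, oneForm_star]
  have h3 := congrArg U.conjTranspose.mulVec h1
  rw [Matrix.mulVec_mulVec, hU.conjTranspose_mul, Matrix.one_mulVec] at h3
  have h : slice B (oneForm A) ∘ₗ hU.toAlgHom.toLinearMap =
      LinearMap.toSpanSingleton ℂ B 1 ∘ₗ oneForm A := by
    refine e.ext fun j => ?_
    have h4 := congrArg star (congrFun h3 j)
    simp only [h2, Matrix.mulVec, dotProduct, star_sum, star_smul, star_star, star_one,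
      Matrix.conjTranspose_apply, mul_smul_comm, mul_one] at h4
    simp [hU.toAlgHom_basis, h4]
  exact LinearMap.congr_fun h x

theorem QutRelations.map_toAlgHom (hU : QutRelations e T U) (a : I) (x : A) :
    TensorProduct.map (T a) LinearMap.id (hU.toAlgHom x) = hU.toAlgHom (T a x) := by
  have h : TensorProduct.map (T a) LinearMap.id ∘ₗ hU.toAlgHom.toLinearMap =
      hU.toAlgHom.toLinearMap ∘ₗ T a := by
    refine e.ext fun j => ?_
    simp only [LinearMap.comp_apply, AlgHom.toLinearMap_apply]
    conv_rhs => rw [← e.sum_repr (T a (e j))]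
    simp only [map_sum, map_smul, hU.toAlgHom_basis, TensorProduct.map_tmul, LinearMap.id_apply,
      Finset.smul_sum]
    rw [Finset.sum_comm]
    have hc : ∀ i, ∑ k, e.repr (T a (e j)) k • U i k = ∑ k, e.repr (T a (e k)) i • U k j :=
      fun i => by
        have h := congrFun (congrFun (hU.comm a) i) j
        simpa only [Matrix.mul_apply, Matrix.map_apply, LinearMap.toMatrix_apply,
          ← Algebra.smul_def, ← Algebra.commutes] using h
    simp only [← TensorProduct.tmul_smul, ← TensorProduct.tmul_sum, hc]
    simp only [TensorProduct.tmul_sum, TensorProduct.tmul_smul, TensorProduct.smul_tmul']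
    rw [Finset.sum_comm]
    refine Finset.sum_congr rfl fun k _ => ?_
    rw [← TensorProduct.sum_tmul, e.sum_repr]
  exact LinearMap.congr_fun h x

/-- The homomorphism `(ε ⊗ id)β` sends `u` to `U`. It respects the involution because both `U*` and
the image of `u*` are inverse to `U`, and the entries of `u` span `A`. -/
theorem exists_starAlgHom_coeffMatrix [StarModule ℂ B] {P : I → A}
    (hP : Submodule.span ℂ (Set.range P) = LinearMap.ker (Coalgebra.counit (R := ℂ) (A := A)))
    (he : IsOrthonormalFor (oneForm A) e)
    (hU : QutRelations e (fun i => convolution (P i)) U) :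
    ∃ f : A →⋆ₐ[ℂ] B, ∀ i j, f ((comulAction A).coeffMatrix e i j) = U i j := by
  set u := (comulAction A).coeffMatrix e with hu
  set f := sliceCounitHom hU.toAlgHom with hf
  have hfβ := map_sliceCounitHom_comul (β := hU.toAlgHom) hP (hU.slice_toAlgHom he) hU.map_toAlgHom
  have hfu : ∀ i j, f (u i j) = U i j := fun i j => by
    have h := congrArg (slice B (e.coord i)) (hfβ (e j))
    rw [hU.toAlgHom_basis, slice_coord_sum, slice_map_right] at h
    exact h
  have hfU : u.map f = U := Matrix.ext hfu
  have hinv : U * (u.conjTranspose.map f) = 1 := by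
    rw [← hfU, ← Matrix.map_mul, hu, coeff_mul_conjTranspose he, Matrix.map_one f (map_zero f)
      (map_one f)]
  have hstaru : ∀ i j, f (star (u i j)) = star (f (u i j)) := fun i j => by
    have h0 : U.conjTranspose = u.conjTranspose.map f :=
      left_inv_eq_right_inv hU.conjTranspose_mul hinv
    have h := congrFun (congrFun h0 j) i
    rw [hfu]
    exact h.symm
  refine ⟨{ f with map_star' := fun x => ?_ }, hfu⟩
  change f (star x) = star (f x)
  induction x using coeff_induction e with
  | coeff i j => exact hstaru i j
  | zero => simp
  | add x y hx hy => simp [hx, hy]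
  | smul c x hx => simp [hx]

theorem isPresentedByQutRelations_comulAction {P : I → A}
    (hP : Submodule.span ℂ (Set.range P) = LinearMap.ker (Coalgebra.counit (R := ℂ) (A := A))) :
    IsPresentedByQutRelations.{u, v} (fun i => convolution (P i)) (comulAction A) := by
  intro n e he
  refine ⟨qutRelations_coeffMatrix he P, fun B _ _ _ _ U hU => ?_⟩
  obtain ⟨f, hf⟩ := exists_starAlgHom_coeffMatrix hP he hU
  refine ⟨f, hf, fun g hg => StarAlgHom.ext fun x => ?_⟩
  induction x using coeff_induction e with
  | coeff i j => rw [hf, hg]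
  | zero => simp
  | add x y hx hy => simp [hx, hy]
  | smul c x hx => simp [hx]

end Presentation

end Universality

theorem proposition4p3 (A : Type u) [Ring A] [StarRing A] [HopfAlgebra ℂ A] [StarModule ℂ A]
    [IsFiniteQuantumGroup A] :
    ∃ (k : ℕ) (P : Fin k → A),
      (∀ i, IsStarProjection (P i)) ∧
      Submodule.span ℂ (Set.range P) = LinearMap.ker (Coalgebra.counit (R := ℂ) (A := A)) ∧
      (∀ i, IsQuantumGraph (convolution (P i)) ∧ HasNoLoops (convolution (P i))) ∧
      IsQutIntersection.{u, v} (fun i => convolution (P i)) (comulAction A) ∧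
      IsPresentedByQutRelations.{u, v} (fun i => convolution (P i)) (comulAction A) := by
  obtain ⟨k, P, hproj, hspan⟩ := exists_isStarProjection_span_eq_ker_counit (A := A)
  refine ⟨k, P, hproj, hspan, fun i => ⟨isQuantumGraph_convolution (hproj i),
    hasNoLoops_convolution ?_⟩, isQutIntersection_comulAction hspan,
    isPresentedByQutRelations_comulAction hspan⟩
  have h : P i ∈ LinearMap.ker (Coalgebra.counit (R := ℂ) (A := A)) := by
    rw [← hspan]
    exact Submodule.subset_span ⟨i, rfl⟩
  exact h
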